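/- Let $N>2$ be an integer and let $f_1:\mathbb R\to\mathbb R$ be odd, continuous on $[0,\infty)$ and $C^1$ on $(0,\infty)$ except possibly at finitely many points, with $f_1(0)=0$. Put $F(s)=\int_0^s f_1(t)\,dt$, and assume: $(H_1)$ there are $b\ge 0$ and $\epsilon>0$ such that $f_1>0$ on $(b,\infty)$, $f_1\le 0$ on $[0,b]$ and $f_1<0$ on $(0,\epsilon)$, and there is a unique $\beta\ge b$ with $F(\beta)=0$; $(H_2)$ $(F/f_1)'(s)>\frac{N-2}{2N}$ for all $s>\beta$ at which $f_1$ is differentiable. Let $\alpha_*^1$ be the initial value of a ground state of $f_1$, that is, there is a nonconstant solution $w\ge 0$ of $w''+\frac{N-1}{r}w'+f_1(w)=0$ for $r>0$ with $w(0)=\alpha_*^1$, $w'(0)=0$ and $\lim_{r\to\infty}w(r)=0$. Let $\alpha_1>\alpha_*^1$ be a point at which $f_1$ is differentiable, and let $K$ satisfy $$(N-2)(\alpha_1-\alpha_*^1)<K<N\frac{f_1(\alpha_1)}{f_1'(\alpha_1)},\qquad K<(N-2)\alpha_1,$$ where the bound $N f_1(\alpha_1)/f_1'(\alpha_1)$ is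 read as $+\infty$ if $f_1'(\alpha_1)\le 0$. Then there is $\delta>0$ with the following property. Let $g:\mathbb R\to\mathbb R$ be any function with $g=f_1$ on $[0,\alpha_1]$ (for instance $g=f_1$), let $0\le a\le r_0$ with $0<r_0<\delta$, and let $u$ be a solution of $u''+\frac{N-1}{r}u'+g(u)=0$ on $[a,\infty)$ ($C^1$ on $[a,\infty)$, the equation holding for $r>a$) that is strictly decreasing on $[a,r_0]$ and reaches $\alpha_1$ at $r_0$ with $u(r_0)=\alpha_1$, $u'(r_0)<0$ and $|u'(r_0)\,r_0|=K$. Then $u$ stays positive for all $r\in[a,\infty]$, that is, there is $c>0$ with $u(r)\ge c$ for all $r\ge a$. Moreover, such a $K$ always exists if $f_1$ also satisfies $(H_3)$ $s f_1'(s)/f_1(s)$ is nonincreasing in $s>b$ (over the points where $f_1$ is differentiable), $f_1$ is differentiable at $\beta$, and $\beta f_1'(\beta)/f_1(\beta)<\frac{N}{N-2}$. -/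

import Mathlib

open Set Filter Topology

/-- The primitive `F(s) = ∫₀ˢ f(t) dt`. -/
noncomputable def primitiveF (f : ℝ → ℝ) (s : ℝ) : ℝ := ∫ t in (0 : ℝ)..s, f t

/-- Condition `(H₁)` on the (oddly extended) nonlinearity `f : ℝ → ℝ`, with `b` the point above
which `f` is positive and `β` the unique zero of `F` in `[b, ∞)`. -/
structure CondH1 (f : ℝ → ℝ) (b β : ℝ) : Prop where
  continuousOn : ContinuousOn f (Ici 0)
  /-- `f` is `C¹` on `(0, ∞)` except possibly at finitely many points. -/
  contDiffOn : ∃ S : Set ℝ, S.Finite ∧ ContDiffOn ℝ 1 f (Ioi 0 \ S)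
  map_zero : f 0 = 0
  b_nonneg : 0 ≤ b
  pos_of_gt : ∀ s, b < s → 0 < f s
  nonpos_of_le : ∀ s, 0 ≤ s → s ≤ b → f s ≤ 0
  neg_near_zero : ∃ ε > 0, ∀ s, 0 < s → s < ε → f s < 0
  odd : ∀ s, f (-s) = -f s
  b_le_beta : b ≤ β
  primitive_beta : primitiveF f β = 0
  beta_unique : ∀ s, b ≤ s → primitiveF f s = 0 → s = β

/-- Condition `(H₂)`: `(F/f)'(s) > (N-2)/(2N)` for all `s > β` at which `f` is differentiable
(all but finitely many `s` under `(H₁)`; since `F > 0` and `f > 0` there, these are exactly the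
points `s > β` at which `F/f` is differentiable). -/
def CondH2 (N : ℕ) (f : ℝ → ℝ) (β : ℝ) : Prop :=
  ∀ s, β < s → DifferentiableAt ℝ f s →
    ((N : ℝ) - 2) / (2 * N) < deriv (fun t => primitiveF f t / f t) s

/-- Condition `(H₃)`: `s f'(s) / f(s)` is decreasing for `s > b` (where `f'` exists) and its value
at `β` is less than `N / (N - 2)`. -/
structure CondH3 (N : ℕ) (f : ℝ → ℝ) (b β : ℝ) : Prop where
  antitoneOn : AntitoneOn (fun s => s * deriv f s / f s) {s | b < s ∧ DifferentiableAt ℝ f s}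
  differentiableAt_beta : DifferentiableAt ℝ f β
  lt_at_beta : β * deriv f β / f β < (N : ℝ) / ((N : ℝ) - 2)

/-- `u`, with derivative `v = u'`, is a solution of `u'' + (N-1)/r u' + g(u) = 0` on `[a, ∞)`:
`u` is `C¹` on `[a, ∞)` (one-sided at `a`), and the equation holds for all `r > a`. -/
structure IsRadialSolution (N : ℕ) (g : ℝ → ℝ) (a : ℝ) (u v : ℝ → ℝ) : Prop where
  hasDeriv : ∀ r, a ≤ r → HasDerivWithinAt u (v r) (Ici a) r
  continuousOn : ContinuousOn v (Ici a)
  equation : ∀ r, a < r →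
    HasDerivAt v (-(((N : ℝ) - 1) / r * v r + g (u r))) r

/-- `α` is the initial value of a (radial) ground state, i.e. of a first bound state: a
nonconstant, nonnegative solution on `[0, ∞)` with `u(0) = α`, `u'(0) = 0`, `u(r) → 0`. -/
def IsGroundStateValue (N : ℕ) (f : ℝ → ℝ) (α : ℝ) : Prop :=
  ∃ u v : ℝ → ℝ, IsRadialSolution N f 0 u v ∧ u 0 = α ∧ v 0 = 0 ∧
    (∀ r, 0 ≤ r → 0 ≤ u r) ∧ (∃ r, 0 ≤ r ∧ u r ≠ u 0) ∧ Tendsto u atTop (𝓝 0)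

/-- The range of `K`: `(N-2)(α₁ - α_*) < K`, `K < N f(α₁)/f'(α₁)`, and `K < (N-2) α₁`.
The second bound is written without division, so that it is void when `f'(α₁) ≤ 0`
(recall `f(α₁) > 0` and `K > 0`). -/
def IsAdmissible (N : ℕ) (f : ℝ → ℝ) (αs α₁ K : ℝ) : Prop :=
  ((N : ℝ) - 2) * (α₁ - αs) < K ∧ K * deriv f α₁ < N * f α₁ ∧ K < ((N : ℝ) - 2) * α₁

/-! ### One-variable calculus -/

/-! Write `N = k + 2`. Launched from a tiny `r₀`, the solution nearly satisfies `(r^(N-1) u')' = 0`,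
so it follows the harmonic profile `α₁ - K/k + (K/k)(r₀/r)^k` up to `O(r²)`. At a small fixed radius
`ε` its height is close to `α₀ = α₁ - K/k` and its slope close to zero, uniformly as `r₀ → 0`
(`exists_arrival`). The bounds on `K` say `0 < α₀ < αs`: beyond `ε` the solution behaves like one
started at rest strictly below the ground state.

The energy `u'² + 2F(u)` does not increase where `g = f`. Once it is negative with `u > 0`, the
solution cannot approach height `0`, where `F` vanishes (`IsRadialSolution.exists_lower_bound`). For
`α₀ < β` it is negative already at `ε`. For `β ≤ α₀`, suppose it never becomes negative while `u >
0`. Then `u` decreases through all heights down to `0` and can be compared with the ground state at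
equal height `s`, with radii `r, ρ` and slopes `p, q`, starting from `p < q`.

Above `β` the functional is `G = r(p² + 2F)/p`. Condition `(H₂)` yields the Pohozaev inequality `f G
> 2 N F` along the ground state; it keeps `G` smaller for `u` as long as `p ≤ q`, and this in turn
prevents `p` from catching up with `q`. Below `β`, where `F ≤ 0`, the functional is `W = r √(p² +
2F)`, and the gap of `W` in favour of the ground state cannot shrink as `s` falls. At `β` both
functionals equal `r p`, so the gap is inherited. Thus `W` stays away from zero along the ground
state (`exists_le_weightedSpeed`), whereas its decay makes `W` arbitrarily small near height `0`
(`exists_weightedSpeed_small`): a contradiction. -/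

lemma lt_of_hasDerivAt_pos {φ φ' : ℝ → ℝ} {a b : ℝ} (hab : a < b)
    (hc : ContinuousOn φ (Icc a b)) (hd : ∀ x ∈ Ioo a b, HasDerivAt φ (φ' x) x)
    (hp : ∀ x ∈ Ioo a b, 0 < φ' x) : φ a < φ b := by
  obtain ⟨c, hc', h⟩ := exists_hasDerivAt_eq_slope φ φ' hab hc hd
  have := hp c hc'
  rw [h, div_pos_iff_of_pos_right (by linarith)] at this
  linarith

lemma le_of_hasDerivAt_nonneg {φ φ' : ℝ → ℝ} {a b : ℝ} (hab : a ≤ b)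
    (hc : ContinuousOn φ (Icc a b)) (hd : ∀ x ∈ Ioo a b, HasDerivAt φ (φ' x) x)
    (hp : ∀ x ∈ Ioo a b, 0 ≤ φ' x) : φ a ≤ φ b := by
  rcases hab.eq_or_lt with rfl | hab
  · exact le_rfl
  obtain ⟨c, hc', h⟩ := exists_hasDerivAt_eq_slope φ φ' hab hc hd
  have h0 := hp c hc'
  rw [h, le_div_iff₀ (by linarith)] at h0
  linarith

/-- Serves the Pohozaev monotonicity, which must cross the finitely many heights where `f` is not
differentiable. Each exceptional point splits the interval in two. -/
lemma lt_of_hasDerivAt_pos_off_finite {φ φ' : ℝ → ℝ} {S : Set ℝ} (hS : S.Finite) :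
    ∀ {a b : ℝ}, a < b → ContinuousOn φ (Icc a b) →
      (∀ x ∈ Ioo a b \ S, HasDerivAt φ (φ' x) x) → (∀ x ∈ Ioo a b \ S, 0 < φ' x) →
      φ a < φ b := by
  induction S, hS using Set.Finite.induction_on with
  | empty =>
    intro a b hab hc hd hp
    exact lt_of_hasDerivAt_pos hab hc (fun x hx => hd x ⟨hx, by simp⟩)
      (fun x hx => hp x ⟨hx, by simp⟩)
  | @insert y S _ _ ih =>
    intro a b hab hc hd hp
    have key : ∀ c d, a ≤ c → c < d → d ≤ b → y ∉ Ioo c d → φ c < φ d := by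
      intro c d hac hcd hdb hy
      have hsub : ∀ x ∈ Ioo c d \ S, x ∈ Ioo a b \ insert y S := by
        intro x hx
        refine ⟨⟨hac.trans_lt hx.1.1, hx.1.2.trans_le hdb⟩, ?_⟩
        rintro (rfl | h)
        · exact hy hx.1
        · exact hx.2 h
      exact ih hcd (hc.mono (Icc_subset_Icc hac hdb)) (fun x hx => hd x (hsub x hx))
        (fun x hx => hp x (hsub x hx))
    by_cases hy : y ∈ Ioo a b
    · exact (key a y le_rfl hy.1 hy.2.le (by simp)).trans
        (key y b hy.1.le hy.2 le_rfl (by simp))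
    · exact key a b le_rfl hab le_rfl hy

lemma HasDerivAt.eventually_gt_right {d : ℝ → ℝ} {d' s : ℝ} (h : HasDerivAt d d' s)
    (hd : 0 < d') : ∀ᶠ t in 𝓝[>] s, d s < d t := by
  have h1 := (hasDerivAt_iff_tendsto_slope.1 h).mono_left
    (nhdsWithin_mono s (fun x (hx : s < x) => (ne_of_gt hx : x ≠ s)))
  filter_upwards [h1.eventually (lt_mem_nhds hd), self_mem_nhdsWithin] with t ht hst
  rw [slope_def_field, div_pos_iff_of_pos_right (sub_pos.2 hst)] at ht
  linarith

lemma HasDerivAt.eventually_gt_left {d : ℝ → ℝ} {d' s : ℝ} (h : HasDerivAt d d' s)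
    (hd : d' < 0) : ∀ᶠ t in 𝓝[<] s, d s < d t := by
  have h1 := (hasDerivAt_iff_tendsto_slope.1 h).mono_left
    (nhdsWithin_mono s (fun x (hx : x < s) => (ne_of_lt hx : x ≠ s)))
  filter_upwards [h1.eventually (gt_mem_nhds hd), self_mem_nhdsWithin] with t ht hst
  have hst' : t - s < 0 := sub_neg.2 hst
  rw [slope_def_field, div_neg_iff] at ht
  rcases ht with ht | ht <;> linarith [ht.1, ht.2]

/-- At the largest point where `d ≥ 0` the function vanishes, and a positive derivative there would
make it positive just to the right. -/
lemma neg_of_barrier {d : ℝ → ℝ} {l s₀ : ℝ} (hc : ContinuousOn d (Icc l s₀)) (h0 : d s₀ < 0)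
    (hb : ∀ s₁ ∈ Ico l s₀, d s₁ = 0 → (∀ s ∈ Ioc s₁ s₀, d s < 0) →
      ∃ d' > 0, HasDerivAt d d' s₁) :
    ∀ s ∈ Icc l s₀, d s < 0 := by
  by_contra! hcon
  obtain ⟨s, hs, hds⟩ := hcon
  have hK : IsCompact (Icc l s₀ ∩ d ⁻¹' Ici 0) :=
    isCompact_Icc.of_isClosed_subset (hc.preimage_isClosed_of_isClosed isClosed_Icc isClosed_Ici)
      inter_subset_left
  obtain ⟨s₁, hs₁, hmax⟩ := hK.exists_isGreatest ⟨s, hs, hds⟩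
  have hd1 : 0 ≤ d s₁ := hs₁.2
  have hlt : s₁ < s₀ := lt_of_le_of_ne hs₁.1.2 (fun h => by rw [h] at hd1; linarith)
  have hneg : ∀ t ∈ Ioc s₁ s₀, d t < 0 := by
    intro t ht
    by_contra! hdt
    exact absurd (hmax ⟨⟨hs₁.1.1.trans ht.1.le, ht.2⟩, hdt⟩) (not_le.2 ht.1)
  have hz : d s₁ = 0 := by
    obtain ⟨t, ht, hdt⟩ := intermediate_value_Icc' hlt.le
      (hc.mono (Icc_subset_Icc hs₁.1.1 le_rfl)) ⟨h0.le, hd1⟩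
    rcases ht.1.eq_or_lt with rfl | h
    · exact hdt
    · exact absurd hdt (hneg t ⟨h, ht.2⟩).ne
  obtain ⟨d', hd', hD⟩ := hb s₁ ⟨hs₁.1.1, hlt⟩ hz hneg
  obtain ⟨t, ht, ht2⟩ := ((hD.eventually_gt_right hd').and
    (Ioc_mem_nhdsGT hlt)).exists
  have := hneg t ht2
  linarith

lemma exists_first_zero {φ : ℝ → ℝ} {a : ℝ} (hc : ContinuousOn φ (Ici a)) (ha : 0 < φ a)
    (h : ∃ r, a ≤ r ∧ φ r ≤ 0) : ∃ R, a < R ∧ φ R = 0 ∧ ∀ t ∈ Ico a R, 0 < φ t := by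
  obtain ⟨r, har, hr⟩ := h
  have hcr : ContinuousOn φ (Icc a r) := hc.mono Icc_subset_Ici_self
  have hK : IsCompact (Icc a r ∩ φ ⁻¹' Iic 0) :=
    isCompact_Icc.of_isClosed_subset (hcr.preimage_isClosed_of_isClosed isClosed_Icc isClosed_Iic)
      inter_subset_left
  obtain ⟨R, hR, hmin⟩ := hK.exists_isLeast ⟨r, ⟨har, le_rfl⟩, hr⟩
  have hR0 : φ R ≤ 0 := hR.2
  have haR : a < R := lt_of_le_of_ne hR.1.1 (fun h => by rw [← h] at hR0; linarith)
  have hpos : ∀ t ∈ Ico a R, 0 < φ t := by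
    intro t ht
    by_contra! hdt
    exact absurd (hmin ⟨⟨ht.1, ht.2.le.trans hR.1.2⟩, hdt⟩) (not_le.2 ht.2)
  refine ⟨R, haR, ?_, hpos⟩
  obtain ⟨t, ht, hdt⟩ := intermediate_value_Icc' haR.le
    (hcr.mono (Icc_subset_Icc le_rfl hR.1.2)) ⟨hR0, ha.le⟩
  rcases ht.2.eq_or_lt with rfl | h
  · exact hdt
  · exact absurd hdt (hpos t ⟨ht.1, h⟩).ne'

/-! ### The nonlinearity and its primitive -/

lemma primitiveF_zero (f : ℝ → ℝ) : primitiveF f 0 = 0 := by simp [primitiveF]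

namespace CondH1
variable {f : ℝ → ℝ} {b β : ℝ}

lemma continuous (h : CondH1 f b β) : Continuous f := by
  have h2 : ContinuousOn f (Iic 0) := by
    have : ContinuousOn (fun s => -f (-s)) (Iic 0) :=
      (h.continuousOn.comp continuousOn_neg (fun s hs => by simpa using hs)).neg
    exact this.congr (fun s _ => by simp [h.odd])
  have := h.continuousOn.union_of_isClosed h2 isClosed_Ici isClosed_Iic
  rwa [Ici_union_Iic, continuousOn_univ] at this

lemma hasDerivAt_primitiveF (h : CondH1 f b β) (s : ℝ) : HasDerivAt (primitiveF f) (f s) s :=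
  intervalIntegral.integral_hasDerivAt_right (h.continuous.intervalIntegrable _ _)
    (h.continuous.stronglyMeasurableAtFilter _ _) h.continuous.continuousAt

lemma continuous_primitiveF (h : CondH1 f b β) : Continuous (primitiveF f) :=
  continuous_iff_continuousAt.2 fun s => (h.hasDerivAt_primitiveF s).continuousAt

lemma b_pos (h : CondH1 f b β) : 0 < b := by
  obtain ⟨ε, hε, hn⟩ := h.neg_near_zero
  by_contra! hb
  have h1 := h.pos_of_gt (ε / 2) (by linarith)
  have h2 := hn (ε / 2) (by linarith) (by linarith)
  linarith

lemma primitiveF_neg_of_le_b (h : CondH1 f b β) {s : ℝ} (hs : 0 < s) (hsb : s ≤ b) :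
    primitiveF f s < 0 := by
  -- Strictness comes only from `(0, ε)`; beyond it `f ≤ 0` merely keeps `F` from rising.
  obtain ⟨ε, hε, hn⟩ := h.neg_near_zero
  set t := min (ε / 2) s with ht
  have ht0 : 0 < t := lt_min (by linarith) hs
  have h1 := lt_of_hasDerivAt_pos (φ := fun x => -primitiveF f x) (φ' := fun x => -f x) ht0
    h.continuous_primitiveF.neg.continuousOn (fun x _ => (h.hasDerivAt_primitiveF x).neg)
    (fun x hx => by
      have := hn x hx.1 (hx.2.trans_le ((min_le_left _ _).trans (by linarith)))
      linarith)
  have h2 := le_of_hasDerivAt_nonneg (φ := fun x => -primitiveF f x) (φ' := fun x => -f x)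
    (min_le_right (ε / 2) s)
    h.continuous_primitiveF.neg.continuousOn (fun x _ => (h.hasDerivAt_primitiveF x).neg)
    (fun x hx => by
      have := h.nonpos_of_le x (ht0.le.trans hx.1.le) (hx.2.le.trans hsb)
      linarith)
  simp only [primitiveF_zero] at h1
  linarith

lemma b_lt_beta (h : CondH1 f b β) : b < β := by
  refine lt_of_le_of_ne h.b_le_beta (fun hb => ?_)
  have := h.primitiveF_neg_of_le_b h.b_pos le_rfl
  rw [hb, h.primitive_beta] at this
  exact lt_irrefl _ this

lemma beta_pos (h : CondH1 f b β) : 0 < β := h.b_pos.trans h.b_lt_beta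

lemma primitiveF_lt (h : CondH1 f b β) {s t : ℝ} (hs : b ≤ s) (hst : s < t) :
    primitiveF f s < primitiveF f t :=
  lt_of_hasDerivAt_pos hst h.continuous_primitiveF.continuousOn
    (fun x _ => h.hasDerivAt_primitiveF x) (fun x hx => h.pos_of_gt x (hs.trans_lt hx.1))

lemma primitiveF_neg (h : CondH1 f b β) {s : ℝ} (hs : 0 < s) (hsb : s < β) :
    primitiveF f s < 0 := by
  rcases le_total s b with hb | hb
  · exact h.primitiveF_neg_of_le_b hs hb
  · rw [← h.primitive_beta]; exact h.primitiveF_lt hb hsb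

lemma primitiveF_nonpos (h : CondH1 f b β) {s : ℝ} (hs : 0 ≤ s) (hsb : s ≤ β) :
    primitiveF f s ≤ 0 := by
  rcases hs.eq_or_lt with rfl | hs
  · exact (primitiveF_zero f).le
  rcases hsb.eq_or_lt with rfl | hsb
  · exact h.primitive_beta.le
  · exact (h.primitiveF_neg hs hsb).le

lemma primitiveF_pos (h : CondH1 f b β) {s : ℝ} (hsb : β < s) : 0 < primitiveF f s := by
  rw [← h.primitive_beta]; exact h.primitiveF_lt h.b_le_beta hsb

lemma primitiveF_nonneg (h : CondH1 f b β) {s : ℝ} (hsb : β ≤ s) : 0 ≤ primitiveF f s := by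
  rcases hsb.eq_or_lt with rfl | hsb
  · exact h.primitive_beta.ge
  · exact (h.primitiveF_pos hsb).le

lemma exists_finite_differentiableAt (h : CondH1 f b β) :
    ∃ S : Set ℝ, S.Finite ∧ ∀ s, 0 < s → s ∉ S → DifferentiableAt ℝ f s := by
  obtain ⟨S, hS, hd⟩ := h.contDiffOn
  refine ⟨S, hS, fun s hs hsS => ?_⟩
  have ho : IsOpen (Ioi (0 : ℝ) \ S) := isOpen_Ioi.sdiff hS.isClosed
  exact (hd.differentiableOn one_ne_zero).differentiableAt (ho.mem_nhds ⟨hs, hsS⟩)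

end CondH1

/-! ### Decreasing solutions as functions of their height -/

/-- A decreasing solution written in terms of its value `s`: `r s` is the radius at which the value
`s` is taken and `p s = -u'(r s)`. -/
structure IsHeightProfile (M : ℕ) (f : ℝ → ℝ) (J : Set ℝ) (r p : ℝ → ℝ) : Prop where
  r_pos : ∀ s ∈ J, 0 < r s
  p_pos : ∀ s ∈ J, 0 < p s
  deriv_r : ∀ s ∈ J, HasDerivAt r (-(1 / p s)) s
  deriv_p : ∀ s ∈ J, HasDerivAt p (M / r s - f s / p s) s

/-- The inverse function theorem applied to `u`; openness of `I` gives two-sided derivatives at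
every height taken. -/
lemma exists_heightProfile {M : ℕ} {f u v : ℝ → ℝ} {I J : Set ℝ} (hI : IsOpen I)
    (hpos : ∀ t ∈ I, 0 < t) (hinj : InjOn u I) (hu : ∀ t ∈ I, HasDerivAt u (v t) t)
    (hv : ∀ t ∈ I, HasDerivAt v (-(M / t * v t + f (u t))) t) (hneg : ∀ t ∈ I, v t < 0)
    (hJ : J ⊆ u '' I) :
    ∃ r p : ℝ → ℝ, IsHeightProfile M f J r p ∧ ∀ t ∈ I, r (u t) = t ∧ p (u t) = -v t := by
  have hr : ∀ t ∈ I, Function.invFunOn u I (u t) = t := fun t ht => hinj.leftInvOn_invFunOn ht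
  have hd : ∀ t ∈ I, HasDerivAt (Function.invFunOn u I) (v t)⁻¹ (u t) := by
    intro t ht
    refine (HasStrictDerivAt.to_local_left_inverse
      (hasStrictDerivAt_of_hasDerivAt_of_continuousAt ?_ (hv t ht).continuousAt)
      (hneg t ht).ne ?_).hasDerivAt
    · filter_upwards [hI.mem_nhds ht] with x hx using hu x hx
    · filter_upwards [hI.mem_nhds ht] with x hx using hr x hx
  refine ⟨Function.invFunOn u I, fun s => -v (Function.invFunOn u I s), ⟨?_, ?_, ?_, ?_⟩,
    fun t ht => ⟨hr t ht, by simp only [hr t ht]⟩⟩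
  · intro s hs
    obtain ⟨t, ht, rfl⟩ := hJ hs
    rw [hr t ht]; exact hpos t ht
  · intro s hs
    obtain ⟨t, ht, rfl⟩ := hJ hs
    simp only [hr t ht]; linarith [hneg t ht]
  · intro s hs
    obtain ⟨t, ht, rfl⟩ := hJ hs
    rw [hr t ht]
    convert hd t ht using 1
    rw [one_div, inv_neg, neg_neg]
  · intro s hs
    obtain ⟨t, ht, rfl⟩ := hJ hs
    have h1 := hv t ht
    have h2 := hd t ht
    simp only [hr t ht]
    have h3 : HasDerivAt v (-(M / t * v t + f (u t))) (Function.invFunOn u I (u t)) := by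
      rwa [hr t ht]
    have h4 := (h3.comp (u t) h2).neg
    refine h4.congr_deriv ?_
    have := (hneg t ht).ne
    have := (hpos t ht).ne'
    field_simp
    ring

/-! ### Comparison of two height profiles -/

/-- `r (p² + 2F) / p` along a height profile. -/
noncomputable def energyRatio (f r p : ℝ → ℝ) (s : ℝ) : ℝ :=
  r s * (p s ^ 2 + 2 * primitiveF f s) / p s

/-- `r √(p² + 2F)` along a height profile. -/
noncomputable def weightedSpeed (f r p : ℝ → ℝ) (s : ℝ) : ℝ :=
  r s * √(p s ^ 2 + 2 * primitiveF f s)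

namespace IsHeightProfile
variable {M : ℕ} {f r p ρ q : ℝ → ℝ} {J : Set ℝ} {b β : ℝ}

lemma mono {J' : Set ℝ} (h : IsHeightProfile M f J r p) (hJ : J' ⊆ J) :
    IsHeightProfile M f J' r p :=
  ⟨fun s hs => h.r_pos s (hJ hs), fun s hs => h.p_pos s (hJ hs),
    fun s hs => h.deriv_r s (hJ hs), fun s hs => h.deriv_p s (hJ hs)⟩

lemma hasDerivAt_energyRatio (h : IsHeightProfile M f J r p) (h1 : CondH1 f b β)
    {s : ℝ} (hs : s ∈ J) :
    HasDerivAt (energyRatio f r p) ((M - 1 : ℝ) +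
      (f s * energyRatio f r p s - 2 * (M + 1) * primitiveF f s) / p s ^ 2) s := by
  have hr := h.deriv_r s hs
  have hp := h.deriv_p s hs
  have hF := h1.hasDerivAt_primitiveF s
  have hp0 := (h.p_pos s hs).ne'
  have hr0 := (h.r_pos s hs).ne'
  have := (hr.mul ((hp.pow 2).add (hF.const_mul 2))).div hp hp0
  refine this.congr_deriv ?_
  simp only [energyRatio, Pi.mul_apply, Pi.add_apply, Pi.pow_apply]
  field_simp
  ring

/-- This is the integrating factor for `energyRatio`: its logarithmic derivative `-f/p²` cancels the
term of the ratio's equation that is linear in the ratio. -/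
lemma hasDerivAt_pow_mul (h : IsHeightProfile M f J r p) (hM : 1 ≤ M) {s : ℝ} (hs : s ∈ J) :
    HasDerivAt (fun t => r t ^ M * p t) (-(f s * (r s ^ M * p s)) / p s ^ 2) s := by
  have hr := h.deriv_r s hs
  have hp := h.deriv_p s hs
  have hp0 := (h.p_pos s hs).ne'
  have hr0 := (h.r_pos s hs).ne'
  refine ((hr.pow M).mul hp).congr_deriv ?_
  obtain ⟨m, rfl⟩ : ∃ m, M = m + 1 := ⟨M - 1, by omega⟩
  simp only [Pi.pow_apply, Nat.add_sub_cancel, pow_succ]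
  field_simp
  push_cast
  ring

lemma hasDerivAt_weightedSpeed (h : IsHeightProfile M f J r p) (h1 : CondH1 f b β)
    {s : ℝ} (hs : s ∈ J) (hE : 0 < p s ^ 2 + 2 * primitiveF f s) :
    HasDerivAt (weightedSpeed f r p) ((M - 1) * (p s / √(p s ^ 2 + 2 * primitiveF f s)) +
      (-2 * primitiveF f s) / (p s * √(p s ^ 2 + 2 * primitiveF f s))) s := by
  have hr := h.deriv_r s hs
  have hp := h.deriv_p s hs
  have hF := h1.hasDerivAt_primitiveF s
  have hp0 := (h.p_pos s hs).ne'
  have hr0 := (h.r_pos s hs).ne'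
  have hq : √(p s ^ 2 + 2 * primitiveF f s) ≠ 0 := (Real.sqrt_pos.2 hE).ne'
  have hsq := Real.sq_sqrt hE.le
  have := hr.mul (((hp.pow 2).add (hF.const_mul 2)).sqrt hE.ne')
  refine this.congr_deriv ?_
  simp only [Pi.add_apply, Pi.pow_apply]
  set w := √(p s ^ 2 + 2 * primitiveF f s)
  have hF' : primitiveF f s = (w ^ 2 - p s ^ 2) / 2 := by linarith
  rw [hF']
  field_simp
  ring

/-- The gap in slopes opens wherever the slopes agree and the first profile is nearer the origin. -/
lemma exists_deriv_sub_pos (hu : IsHeightProfile M f J r p) (hw : IsHeightProfile M f J ρ q)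
    (hM : 1 ≤ M) {s : ℝ} (hs : s ∈ J) (hpq : p s - q s = 0) (hr : r s < ρ s) :
    ∃ d' > 0, HasDerivAt (fun t => p t - q t) d' s := by
  refine ⟨_, ?_, (hu.deriv_p s hs).sub (hw.deriv_p s hs)⟩
  rw [sub_eq_zero.1 hpq]
  have : (M : ℝ) / ρ s < M / r s :=
    div_lt_div_of_pos_left (by exact_mod_cast hM) (hu.r_pos s hs) hr
  linarith

lemma continuousOn_p (hu : IsHeightProfile M f J r p) : ContinuousOn p J :=
  fun s hs => (hu.deriv_p s hs).continuousAt.continuousWithinAt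

/-- Multiplied by `r^M p`, the difference of the two ratios has derivative `r^M p (f G_w -
2(M+1)F)(1/p² - 1/q²)`, with `G_w` the second profile's ratio. This is nonnegative when `p ≤ q`, so
a negative difference stays negative downwards. -/
lemma energyRatio_lt_of_le (hu : IsHeightProfile M f J r p) (hw : IsHeightProfile M f J ρ q)
    (h1 : CondH1 f b β) (hM : 1 ≤ M) {l s₀ : ℝ} (hl : l ≤ s₀) (hJ : Icc l s₀ ⊆ J)
    (hT : ∀ s ∈ Icc l s₀, 2 * (M + 1) * primitiveF f s ≤ f s * energyRatio f ρ q s)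
    (hpq : ∀ s ∈ Icc l s₀, p s ≤ q s)
    (hG : energyRatio f r p s₀ < energyRatio f ρ q s₀) :
    energyRatio f r p l < energyRatio f ρ q l := by
  have hD : ∀ s ∈ J, HasDerivAt
      (fun t => (r t ^ M * p t) * (energyRatio f r p t - energyRatio f ρ q t))
      ((r s ^ M * p s) * (f s * energyRatio f ρ q s - 2 * (M + 1) * primitiveF f s) *
        (1 / p s ^ 2 - 1 / q s ^ 2)) s := by
    intro s hs
    have hp0 := (hu.p_pos s hs).ne'
    have hq0 := (hw.p_pos s hs).ne'
    refine ((hu.hasDerivAt_pow_mul hM hs).mul ((hu.hasDerivAt_energyRatio h1 hs).sub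
      (hw.hasDerivAt_energyRatio h1 hs))).congr_deriv ?_
    simp only [Pi.sub_apply]
    field_simp
    ring
  have hpos : ∀ s ∈ J, 0 < r s ^ M * p s := fun s hs =>
    mul_pos (pow_pos (hu.r_pos s hs) M) (hu.p_pos s hs)
  have := le_of_hasDerivAt_nonneg hl
    (fun s hs => (hD s (hJ hs)).continuousAt.continuousWithinAt)
    (fun s hs => hD s (hJ (Ioo_subset_Icc_self hs))) (fun s hs => by
      have hs' := Ioo_subset_Icc_self hs
      refine mul_nonneg (mul_nonneg (hpos s (hJ hs')).le (sub_nonneg.2 (hT s hs'))) ?_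
      rw [sub_nonneg]
      have hp := hu.p_pos s (hJ hs')
      have := hpq s hs'
      exact one_div_le_one_div_of_le (by positivity) (by gcongr))
  have h2 := mul_neg_of_pos_of_neg (hpos s₀ (hJ ⟨hl, le_rfl⟩)) (sub_neg.2 hG)
  have h3 := hpos l (hJ ⟨le_rfl, hl⟩)
  by_contra! hcon
  have h4 := mul_nonneg h3.le (sub_nonneg.2 hcon)
  linarith

/-- A continuity argument from `s₀` downwards. Where `p` would first meet `q`, the ordering of the
ratios reduces to `r < ρ`; the steeper damping term then makes `p - q` increasing there, which
contradicts `p < q` just above. -/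
lemma lt_of_beta_le (hu : IsHeightProfile M f J r p) (hw : IsHeightProfile M f J ρ q)
    (h1 : CondH1 f b β) (hM : 1 ≤ M) {s₀ : ℝ} (hl : β ≤ s₀) (hJ : Icc β s₀ ⊆ J)
    (hT : ∀ s ∈ Icc β s₀, 2 * (M + 1) * primitiveF f s ≤ f s * energyRatio f ρ q s)
    (hpq : p s₀ < q s₀) (hG : energyRatio f r p s₀ < energyRatio f ρ q s₀) :
    p β < q β ∧ energyRatio f r p β < energyRatio f ρ q β := by
  have hneg := neg_of_barrier (d := fun s => p s - q s)
    ((hu.continuousOn_p.sub hw.continuousOn_p).mono hJ) (sub_neg.2 hpq) (by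
      intro s₁ hs₁ hz hlt
      have hs₁' := Ico_subset_Icc_self hs₁
      refine hu.exists_deriv_sub_pos hw hM (hJ hs₁') hz ?_
      have := hu.energyRatio_lt_of_le hw h1 hM hs₁.2.le
        ((Icc_subset_Icc hs₁.1 le_rfl).trans hJ) (fun s hs => hT s ⟨hs₁.1.trans hs.1, hs.2⟩)
        (fun s hs => by
          rcases hs.1.eq_or_lt with rfl | h
          · exact (sub_eq_zero.1 hz).le
          · linarith [hlt s ⟨h, hs.2⟩]) hG
      have hp := hu.p_pos s₁ (hJ hs₁')
      have hF := h1.primitiveF_nonneg hs₁.1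
      simp only [energyRatio] at this
      rw [← sub_eq_zero.1 hz, div_lt_div_iff_of_pos_right hp] at this
      exact lt_of_mul_lt_mul_right this (by positivity))
  refine ⟨sub_neg.1 (hneg β ⟨le_rfl, hl⟩), hu.energyRatio_lt_of_le hw h1 hM hl hJ hT
    (fun s hs => (sub_neg.1 (hneg s hs)).le) hG⟩

/-- For `F ≤ 0` both terms in the derivative of `weightedSpeed` are nonincreasing in the slope, so
the smaller slope has the larger derivative. -/
lemma weightedSpeed_sub_le (hu : IsHeightProfile M f J r p) (hw : IsHeightProfile M f J ρ q)
    (h1 : CondH1 f b β) (hM : 1 ≤ M) {l s₀ : ℝ} (hl : l ≤ s₀) (hl0 : 0 < l) (hs₀ : s₀ ≤ β)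
    (hJ : Icc l s₀ ⊆ J)
    (hE : ∀ s ∈ Icc l s₀, 0 < p s ^ 2 + 2 * primitiveF f s)
    (hpq : ∀ s ∈ Icc l s₀, p s ≤ q s) :
    weightedSpeed f r p l - weightedSpeed f ρ q l ≤
      weightedSpeed f r p s₀ - weightedSpeed f ρ q s₀ := by
  have hEw : ∀ s ∈ Icc l s₀, 0 < q s ^ 2 + 2 * primitiveF f s := fun s hs => by
    have := hE s hs
    have := pow_le_pow_left₀ (hu.p_pos s (hJ hs)).le (hpq s hs) 2
    linarith
  have hD := fun s (hs : s ∈ Icc l s₀) => (hu.hasDerivAt_weightedSpeed h1 (hJ hs) (hE s hs)).sub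
    (hw.hasDerivAt_weightedSpeed h1 (hJ hs) (hEw s hs))
  refine le_of_hasDerivAt_nonneg hl
    (fun s hs => (hD s hs).continuousAt.continuousWithinAt)
    (fun s hs => hD s (Ioo_subset_Icc_self hs)) (fun s hs => ?_)
  replace hs := Ioo_subset_Icc_self hs
  have hF : 0 ≤ -2 * primitiveF f s := by
    linarith [h1.primitiveF_nonpos (hl0.le.trans hs.1) (hs.2.trans hs₀)]
  have hp := hu.p_pos s (hJ hs)
  have hq := hw.p_pos s (hJ hs)
  have hpq' := hpq s hs
  have hE1 := hE s hs
  have hE2 := hEw s hs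
  have hs1 := Real.sqrt_pos.2 hE1
  have hs2 := Real.sqrt_pos.2 hE2
  have hle : √(p s ^ 2 + 2 * primitiveF f s) ≤ √(q s ^ 2 + 2 * primitiveF f s) :=
    Real.sqrt_le_sqrt (by gcongr)
  have hM' : (0 : ℝ) ≤ M - 1 := by
    have : (1 : ℝ) ≤ M := by exact_mod_cast hM
    linarith
  have hA : q s / √(q s ^ 2 + 2 * primitiveF f s) ≤ p s / √(p s ^ 2 + 2 * primitiveF f s) := by
    rw [div_le_div_iff₀ hs2 hs1]
    -- After squaring and cancelling `p² q²`, the claim is `2F q² ≤ 2F p²`.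
    refine (sq_le_sq₀ (by positivity) (by positivity)).1 ?_
    rw [mul_pow, mul_pow, Real.sq_sqrt hE1.le, Real.sq_sqrt hE2.le]
    have : p s ^ 2 ≤ q s ^ 2 := by gcongr
    nlinarith
  have hB : (-2 * primitiveF f s) / (q s * √(q s ^ 2 + 2 * primitiveF f s)) ≤
      (-2 * primitiveF f s) / (p s * √(p s ^ 2 + 2 * primitiveF f s)) := by
    gcongr
  have := mul_le_mul_of_nonneg_left hA hM'
  linarith

/-- The constant is the initial gap of the weighted speeds: it persists downwards, and the weighted
speed of the first profile is nonnegative. Where the slopes agree the square roots agree too, so the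
gap gives `r < ρ` and the barrier applies. -/
lemma exists_le_weightedSpeed_of_le_beta (hM : 1 ≤ M) (h1 : CondH1 f b β) {s₀ : ℝ}
    (hs₀ : s₀ ≤ β)
    (hu : IsHeightProfile M f (Ioc 0 s₀) r p) (hw : IsHeightProfile M f (Ioc 0 s₀) ρ q)
    (hE : ∀ s ∈ Ioc 0 s₀, 0 < p s ^ 2 + 2 * primitiveF f s)
    (hpq : p s₀ < q s₀) (hW : weightedSpeed f r p s₀ < weightedSpeed f ρ q s₀) :
    ∃ c > 0, ∀ s ∈ Ioc 0 s₀, c ≤ weightedSpeed f ρ q s := by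
  have hsub : ∀ l, 0 < l → Icc l s₀ ⊆ Ioc 0 s₀ := fun l hl s hs => ⟨hl.trans_le hs.1, hs.2⟩
  have hneg : ∀ l ∈ Ioc 0 s₀, ∀ s ∈ Icc l s₀, p s - q s < 0 := by
    intro l hl
    refine neg_of_barrier (d := fun s => p s - q s)
      ((hu.continuousOn_p.sub hw.continuousOn_p).mono (hsub l hl.1)) (sub_neg.2 hpq) ?_
    intro s₁ hs₁ hz hlt
    have hs0 : 0 < s₁ := hl.1.trans_le hs₁.1
    have hs₁' : s₁ ∈ Ioc 0 s₀ := ⟨hs0, hs₁.2.le⟩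
    refine hu.exists_deriv_sub_pos hw hM hs₁' hz ?_
    have := hu.weightedSpeed_sub_le hw h1 hM hs₁.2.le hs0 hs₀ (hsub s₁ hs0)
      (fun s hs => hE s (hsub s₁ hs0 hs))
      (fun s hs => by
        rcases hs.1.eq_or_lt with rfl | h
        · exact (sub_eq_zero.1 hz).le
        · linarith [hlt s ⟨h, hs.2⟩])
    have h2 : weightedSpeed f r p s₁ < weightedSpeed f ρ q s₁ := by linarith
    simp only [weightedSpeed] at h2
    rw [← sub_eq_zero.1 hz] at h2
    exact lt_of_mul_lt_mul_right h2 (Real.sqrt_nonneg _)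
  refine ⟨_, sub_pos.2 hW, fun s hs => ?_⟩
  have h2 := hu.weightedSpeed_sub_le hw h1 hM hs.2 hs.1 hs₀ (hsub s hs.1)
    (fun t ht => hE t (hsub s hs.1 ht)) (fun t ht => (sub_neg.1 (hneg s hs t ht)).le)
  have h3 : 0 ≤ weightedSpeed f r p s := mul_nonneg (hu.r_pos s hs).le (Real.sqrt_nonneg _)
  linarith

/-- If `u` starts below the ground state with smaller slope and smaller energy ratio and its energy
stays positive down to height `0`, then `r √(p² + 2F)` cannot tend to `0` along the ground state. -/
lemma exists_le_weightedSpeed (hM : 1 ≤ M) (h1 : CondH1 f b β) {s₀ : ℝ} (h0 : 0 < s₀)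
    (hu : IsHeightProfile M f (Ioc 0 s₀) r p) (hw : IsHeightProfile M f (Ioc 0 s₀) ρ q)
    (hE : ∀ s ∈ Ioc 0 s₀, 0 < p s ^ 2 + 2 * primitiveF f s)
    (hT : ∀ s ∈ Icc β s₀, 2 * (M + 1) * primitiveF f s ≤ f s * energyRatio f ρ q s)
    (hpq : p s₀ < q s₀)
    (hG : β ≤ s₀ → energyRatio f r p s₀ < energyRatio f ρ q s₀)
    (hW : s₀ ≤ β → weightedSpeed f r p s₀ < weightedSpeed f ρ q s₀) :
    ∃ c > 0, ∃ s₁ > 0, ∀ s ∈ Ioc 0 s₁, c ≤ weightedSpeed f ρ q s := by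
  rcases le_total s₀ β with h | h
  · obtain ⟨c, hc, hcs⟩ := exists_le_weightedSpeed_of_le_beta hM h1 h hu hw hE hpq (hW h)
    exact ⟨c, hc, s₀, h0, hcs⟩
  · have hβ := h1.beta_pos
    have hsub : Ioc 0 β ⊆ Ioc 0 s₀ := Ioc_subset_Ioc le_rfl h
    have hβm : β ∈ Ioc 0 s₀ := ⟨hβ, h⟩
    obtain ⟨hp, hG'⟩ := hu.lt_of_beta_le hw h1 hM h (fun s hs => ⟨hβ.trans_le hs.1, hs.2⟩) hT
      hpq (hG h)
    -- At height `β` the primitive vanishes, so `energyRatio` and `weightedSpeed` both reduce to `r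
    -- p`.
    obtain ⟨c, hc, hcs⟩ := exists_le_weightedSpeed_of_le_beta hM h1 le_rfl (hu.mono hsub)
      (hw.mono hsub) (fun s hs => hE s (hsub hs)) hp (by
        have hp0 := hu.p_pos β hβm
        have hq0 := hw.p_pos β hβm
        simp only [energyRatio, h1.primitive_beta, mul_zero, add_zero, pow_two, ← mul_assoc,
          mul_div_cancel_right₀ _ hp0.ne', mul_div_cancel_right₀ _ hq0.ne'] at hG'
        simpa only [weightedSpeed, h1.primitive_beta, mul_zero, add_zero, Real.sqrt_sq hp0.le,
          Real.sqrt_sq hq0.le] using hG')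
    exact ⟨c, hc, β, hβ, hcs⟩

end IsHeightProfile

/-! ### Radial solutions -/

/-- Twice the energy, `v² + 2F(u)`. -/
noncomputable def radialEnergy (f u v : ℝ → ℝ) (r : ℝ) : ℝ := v r ^ 2 + 2 * primitiveF f (u r)

namespace IsRadialSolution
variable {M : ℕ} {f g u v : ℝ → ℝ} {a b β : ℝ}

lemma hasDerivAt_u (h : IsRadialSolution (M + 1) g a u v) {r : ℝ} (hr : a < r) :
    HasDerivAt u (v r) r :=
  (h.hasDeriv r hr.le).hasDerivAt (Ici_mem_nhds hr)

lemma hasDerivAt_v (h : IsRadialSolution (M + 1) g a u v) {r : ℝ} (hr : a < r) :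
    HasDerivAt v (-(M / r * v r + g (u r))) r := by
  simpa using h.equation r hr

lemma continuousOn_u (h : IsRadialSolution (M + 1) g a u v) : ContinuousOn u (Ici a) :=
  fun r hr => (h.hasDeriv r hr).continuousWithinAt

lemma hasDerivAt_flux (h : IsRadialSolution (M + 1) g a u v) (ha : 0 ≤ a) {r : ℝ} (hr : a < r) :
    HasDerivAt (fun t => t ^ M * v t) (-(r ^ M * g (u r))) r := by
  have hr0 : r ≠ 0 := (ha.trans_lt hr).ne'
  refine (((hasDerivAt_id r).pow M).mul (h.hasDerivAt_v hr)).congr_deriv ?_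
  rcases M with _ | m
  · simp
  · simp only [Pi.pow_apply, id, Nat.add_sub_cancel, pow_succ]
    field_simp
    ring

lemma continuousOn_flux (h : IsRadialSolution (M + 1) g a u v) :
    ContinuousOn (fun t => t ^ M * v t) (Ici a) :=
  (continuousOn_id.pow M).mul h.continuousOn

lemma continuousOn_radialEnergy (h : IsRadialSolution (M + 1) g a u v) (h1 : CondH1 f b β) :
    ContinuousOn (radialEnergy f u v) (Ici a) :=
  (h.continuousOn.pow 2).add
    ((h1.continuous_primitiveF.comp_continuousOn h.continuousOn_u).const_smul (2 : ℝ))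

lemma hasDerivAt_radialEnergy (h : IsRadialSolution (M + 1) g a u v) (h1 : CondH1 f b β)
    {r : ℝ} (hr : a < r) (hg : g (u r) = f (u r)) :
    HasDerivAt (radialEnergy f u v) (-(2 * (M / r * v r ^ 2))) r := by
  have hF := (h1.hasDerivAt_primitiveF (u r)).comp r (h.hasDerivAt_u hr)
  refine (((h.hasDerivAt_v hr).pow 2).add (hF.const_mul 2)).congr_deriv ?_
  rw [hg]
  ring

lemma radialEnergy_le (h : IsRadialSolution (M + 1) g a u v) (h1 : CondH1 f b β) (ha : 0 ≤ a)
    {r₁ r₂ : ℝ} (har : a ≤ r₁) (hr : r₁ ≤ r₂) (hg : ∀ t ∈ Ioo r₁ r₂, g (u t) = f (u t)) :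
    radialEnergy f u v r₂ ≤ radialEnergy f u v r₁ := by
  have := le_of_hasDerivAt_nonneg (φ := fun t => -radialEnergy f u v t) hr
    ((h.continuousOn_radialEnergy h1).neg.mono (fun t ht => har.trans ht.1))
    (fun t ht => (h.hasDerivAt_radialEnergy h1 (har.trans_lt ht.1) (hg t ht)).neg)
    (fun t ht => by
      have : 0 < t := ha.trans_lt (har.trans_lt ht.1)
      rw [neg_neg]
      positivity)
  linarith

lemma radialEnergy_lt (h : IsRadialSolution (M + 1) g a u v) (h1 : CondH1 f b β) (ha : 0 ≤ a)
    (hM : 1 ≤ M) {r₁ r₂ : ℝ} (har : a ≤ r₁) (hr : r₁ < r₂)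
    (hg : ∀ t ∈ Ioo r₁ r₂, g (u t) = f (u t)) (hv : ∀ t ∈ Ioo r₁ r₂, v t < 0) :
    radialEnergy f u v r₂ < radialEnergy f u v r₁ := by
  have := lt_of_hasDerivAt_pos (φ := fun t => -radialEnergy f u v t) hr
    ((h.continuousOn_radialEnergy h1).neg.mono (fun t ht => har.trans ht.1))
    (fun t ht => (h.hasDerivAt_radialEnergy h1 (har.trans_lt ht.1) (hg t ht)).neg)
    (fun t ht => by
      have : 0 < t := ha.trans_lt (har.trans_lt ht.1)
      have := sq_pos_of_neg (hv t ht)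
      have : (0 : ℝ) < M := by exact_mod_cast hM
      rw [neg_neg]
      positivity)
  linarith

lemma strictAnti_of_neg (h : IsRadialSolution (M + 1) g a u v) {r₁ r₂ : ℝ} (har : a ≤ r₁)
    (hr : r₁ < r₂) (hv : ∀ t ∈ Ioo r₁ r₂, v t < 0) : u r₂ < u r₁ := by
  have := lt_of_hasDerivAt_pos (φ := fun t => -u t) hr
    (h.continuousOn_u.neg.mono (fun t ht => har.trans ht.1))
    (fun t ht => (h.hasDerivAt_u (har.trans_lt ht.1)).neg)
    (fun t ht => by linarith [hv t ht])
  linarith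

/-- A decreasing solution can only stop decreasing, at a positive height, with negative energy. -/
lemma radialEnergy_neg_of_turning (h : IsRadialSolution (M + 1) g a u v) (h1 : CondH1 f b β)
    {r₁ R : ℝ} (har : a ≤ r₁) (hr : r₁ < R) (hv : ∀ t ∈ Ico r₁ R, v t < 0) (hvR : v R = 0)
    (huR : 0 < u R) (hg : g (u R) = f (u R)) : radialEnergy f u v R < 0 := by
  have hub : u R ≤ b := by
    -- Above `b` the equation gives `v' = -f < 0` at `R`, forcing `v > 0` just to its left.
    by_contra! hb
    have hd := h.hasDerivAt_v (har.trans_lt hr)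
    rw [hvR, hg, mul_zero, zero_add] at hd
    obtain ⟨t, ht, ht2⟩ := ((hd.eventually_gt_left (neg_lt_zero.2 (h1.pos_of_gt _ hb))).and
      (Ico_mem_nhdsLT hr)).exists
    linarith [hv t ht2]
  have := h1.primitiveF_neg_of_le_b huR hub
  simp only [radialEnergy, hvR]
  linarith

end IsRadialSolution

/-! ### The ground state -/

section GroundState
variable {M : ℕ} {f w z : ℝ → ℝ} {b β : ℝ}

/-- The energy is nonincreasing and at least `2F(w)`, which tends to `F(0) = 0`; no limit of the
slope is needed. -/
lemma radialEnergy_nonneg_of_tendsto_zero (h : IsRadialSolution (M + 1) f 0 w z)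
    (h1 : CondH1 f b β) (hlim : Tendsto w atTop (𝓝 0)) {r : ℝ} (hr : 0 ≤ r) :
    0 ≤ radialEnergy f w z r := by
  have hl : Tendsto (fun t => 2 * primitiveF f (w t)) atTop (𝓝 (2 * primitiveF f 0)) :=
    ((h1.continuous_primitiveF.tendsto 0).comp hlim).const_mul 2
  rw [primitiveF_zero, mul_zero] at hl
  refine le_of_tendsto hl ?_
  filter_upwards [eventually_ge_atTop r] with t ht
  have := h.radialEnergy_le h1 le_rfl hr ht (fun _ _ => rfl)
  have h2 := sq_nonneg (z t)
  simp only [radialEnergy] at this ⊢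
  linarith

/-- Otherwise the energy starts nonpositive, hence vanishes identically; its dissipation then forces
zero slope, and `w` is constant. -/
lemma beta_lt_groundStateValue (h : IsRadialSolution (M + 1) f 0 w z) (h1 : CondH1 f b β)
    (hM : 1 ≤ M) (hz0 : z 0 = 0) (hnn : 0 ≤ w 0) (hnc : ∃ r, 0 ≤ r ∧ w r ≠ w 0)
    (hlim : Tendsto w atTop (𝓝 0)) : β < w 0 := by
  by_contra! hle
  have hF := h1.primitiveF_nonpos hnn hle
  have hE : ∀ r, 0 ≤ r → radialEnergy f w z r = 0 := by
    intro r hr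
    refine le_antisymm ?_ (radialEnergy_nonneg_of_tendsto_zero h h1 hlim hr)
    refine (h.radialEnergy_le h1 le_rfl le_rfl hr (fun _ _ => rfl)).trans ?_
    simp only [radialEnergy, hz0]
    linarith
  have hz : ∀ r, 0 < r → z r = 0 := by
    intro r hr
    have hd := h.hasDerivAt_radialEnergy h1 hr rfl
    have hd0 : HasDerivAt (radialEnergy f w z) 0 r :=
      (hasDerivAt_const r (0 : ℝ)).congr_of_eventuallyEq (by
        filter_upwards [Ioi_mem_nhds hr] with t ht using hE t (le_of_lt ht))
    have := hd.unique hd0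
    have hM' : (0 : ℝ) < M := by exact_mod_cast hM
    have h3 : (M : ℝ) / r * z r ^ 2 = 0 := by linarith
    rcases mul_eq_zero.1 h3 with h4 | h4
    · exact absurd h4 (by positivity)
    · exact pow_eq_zero_iff two_ne_zero |>.1 h4
  obtain ⟨r, hr, hne⟩ := hnc
  refine hne (le_antisymm ?_ ?_)
  · have := le_of_hasDerivAt_nonneg (φ := fun t => -w t) hr
      (h.continuousOn_u.neg.mono (fun t ht => ht.1))
      (fun t ht => (h.hasDerivAt_u ht.1).neg) (fun t ht => by simp [hz t ht.1])
    linarith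
  · exact le_of_hasDerivAt_nonneg hr (h.continuousOn_u.mono (fun t ht => ht.1))
      (fun t ht => h.hasDerivAt_u ht.1) (fun t ht => by simp [hz t ht.1])

/-- Near the origin `f(w) > 0` drives the flux negative; a later turning point at positive height
would have negative energy. -/
lemma groundState_deriv_neg (h : IsRadialSolution (M + 1) f 0 w z) (h1 : CondH1 f b β)
    (hz0 : z 0 = 0) (hβ : β < w 0) (hlim : Tendsto w atTop (𝓝 0)) {r : ℝ} (hr : 0 < r)
    (hpos : ∀ t ∈ Icc 0 r, 0 < w t) : z r < 0 := by
  have hbw : b < w 0 := h1.b_lt_beta.trans hβ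
  obtain ⟨η, hη, hηb⟩ : ∃ η > 0, ∀ t ∈ Icc 0 η, b < w t := by
    have : ∀ᶠ t in 𝓝[≥] (0 : ℝ), b < w t :=
      (h.continuousOn_u 0 self_mem_Ici).eventually (lt_mem_nhds hbw)
    obtain ⟨η, hη, hs⟩ := (mem_nhdsGE_iff_exists_Icc_subset.1 this)
    exact ⟨η, hη, hs⟩
  have hnear : ∀ t ∈ Ioc 0 η, z t < 0 := by
    intro t ht
    have := lt_of_hasDerivAt_pos (φ := fun t => -(t ^ M * z t)) ht.1
      (h.continuousOn_flux.neg.mono (fun t ht => ht.1))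
      (fun x hx => (h.hasDerivAt_flux le_rfl hx.1).neg)
      (fun x hx => by
        rw [neg_neg]
        exact mul_pos (pow_pos hx.1 M)
          (h1.pos_of_gt _ (hηb x ⟨hx.1.le, hx.2.le.trans ht.2⟩)))
    simp only [hz0, mul_zero, neg_zero, neg_pos] at this
    exact neg_of_mul_neg_right this (pow_pos ht.1 M).le
  by_contra! hcon
  have hηr : η < r := by
    by_contra! hle
    linarith [hnear r ⟨hr, hle⟩]
  obtain ⟨R, hηR, hR0, hRp⟩ := exists_first_zero (φ := fun t => -z t) (a := η)
    (h.continuousOn.neg.mono (Ici_subset_Ici.2 hη.le))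
    (by linarith [hnear η ⟨hη, le_rfl⟩]) ⟨r, hηr.le, by linarith⟩
  have hRr : R ≤ r := by
    by_contra! hlt
    linarith [hRp r ⟨hηr.le, hlt⟩]
  have := h.radialEnergy_neg_of_turning h1 hη.le hηR (fun t ht => by linarith [hRp t ht])
    (by linarith) (hpos R ⟨(hη.trans hηR).le, hRr⟩) rfl
  linarith [radialEnergy_nonneg_of_tendsto_zero h h1 hlim (hη.trans hηR).le]

/-- Strict positivity of the Erbe-Tang functional along the ground state above `β`. -/
lemma groundState_pohozaev_pos (h : IsRadialSolution (M + 1) f 0 w z) (h1 : CondH1 f b β)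
    (h2 : CondH2 (M + 1) f β) (hM : 1 ≤ M) {R : ℝ} (hR : 0 < R)
    (hz : ∀ t ∈ Ioc 0 R, z t < 0) (hβ : β ≤ w R) :
    0 < R ^ (M + 1) * radialEnergy f w z R +
      2 * (M + 1) * (primitiveF f (w R) / f (w R)) * (R ^ M * z R) := by
  have hanti : ∀ t t', 0 ≤ t → t < t' → t' ≤ R → w t' < w t := fun t t' h0 hlt hle =>
    h.strictAnti_of_neg h0 hlt (fun x hx => hz x ⟨h0.trans_lt hx.1, hx.2.le.trans hle⟩)
  have hwβ : ∀ t ∈ Icc 0 R, β ≤ w t := fun t ht => by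
    rcases ht.2.eq_or_lt with rfl | hlt
    · exact hβ
    · exact hβ.trans (hanti t R ht.1 hlt le_rfl).le
  have hf : ∀ t ∈ Icc 0 R, 0 < f (w t) := fun t ht =>
    h1.pos_of_gt _ (h1.b_lt_beta.trans_le (hwβ t ht))
  obtain ⟨S, hS, hSd⟩ := h1.exists_finite_differentiableAt
  have hfin : (Ioo 0 R ∩ w ⁻¹' S).Finite := by
    refine Set.Finite.of_finite_image (f := w) (hS.subset ?_) ?_
    · rintro _ ⟨t, ht, rfl⟩
      exact ht.2
    · intro t ht t' ht' heq
      rcases lt_trichotomy t t' with hlt | rfl | hlt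
      · exact absurd heq (hanti t t' ht.1.1.le hlt ht'.1.2.le).ne'
      · rfl
      · exact absurd heq (hanti t' t ht'.1.1.le hlt ht.1.2.le).ne
  have hsub : Icc 0 R ⊆ Ici (0 : ℝ) := fun t ht => ht.1
  have hcw := h.continuousOn_u.mono hsub
  -- The functional vanishes at radius `0`. With `N = M + 1`, its derivative is `t^M z² (2N (F/f)' -
  -- (N - 2))`, positive by `(H₂)`.
  have := lt_of_hasDerivAt_pos_off_finite hfin hR
    (φ := fun t => t ^ (M + 1) * radialEnergy f w z t +
      2 * (M + 1) * (primitiveF f (w t) / f (w t)) * (t ^ M * z t))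
    (φ' := fun t => t ^ M * z t ^ 2 *
      (2 * (M + 1) * deriv (fun x => primitiveF f x / f x) (w t) - (M - 1)))
    (((continuousOn_id.pow (M + 1)).mul ((h.continuousOn_radialEnergy h1).mono hsub)).add
      ((continuousOn_const.mul ((h1.continuous_primitiveF.comp_continuousOn hcw).div
        (h1.continuous.comp_continuousOn hcw) (fun t ht => (hf t ht).ne'))).mul
        (h.continuousOn_flux.mono hsub)))
    (by
      intro t ht
      have htI := Ioo_subset_Icc_self ht.1
      have hwt : 0 < w t := h1.beta_pos.trans_le (hwβ t htI)
      have hdf : DifferentiableAt ℝ f (w t) := hSd _ hwt (fun hmem => ht.2 ⟨ht.1, hmem⟩)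
      have hq : DifferentiableAt ℝ (fun x => primitiveF f x / f x) (w t) :=
        (h1.hasDerivAt_primitiveF _).differentiableAt.div hdf (hf t htI).ne'
      have hq' := hq.hasDerivAt.comp t (h.hasDerivAt_u ht.1.1)
      refine ((((hasDerivAt_id t).pow (M + 1)).mul
        (h.hasDerivAt_radialEnergy h1 ht.1.1 rfl)).add
        ((hq'.const_mul (2 * ((M : ℝ) + 1))).mul
          (h.hasDerivAt_flux le_rfl ht.1.1))).congr_deriv ?_
      have ht0 : t ≠ 0 := ht.1.1.ne'
      have hf0 := (hf t htI).ne'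
      simp only [Pi.pow_apply, id, Nat.add_sub_cancel, pow_succ, radialEnergy,
        Function.comp_apply]
      push_cast
      field_simp
      ring)
    (by
      intro t ht
      have htI := Ioo_subset_Icc_self ht.1
      have hwt : β < w t := hβ.trans_lt (hanti t R ht.1.1.le ht.1.2 le_rfl)
      have hdf : DifferentiableAt ℝ f (w t) :=
        hSd _ (h1.beta_pos.trans hwt) (fun hmem => ht.2 ⟨ht.1, hmem⟩)
      have hd := h2 _ hwt hdf
      push_cast at hd
      rw [div_lt_iff₀ (by positivity)] at hd
      have hzt := sq_pos_of_neg (hz t ⟨ht.1.1, ht.1.2.le⟩)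
      have htM := pow_pos ht.1.1 M
      exact mul_pos (mul_pos htM hzt) (by linarith))
  simpa [zero_pow (show M ≠ 0 by omega)] using this

/-- If `w` reaches zero, that is a minimum of a nonnegative function, so height, slope and energy
vanish there together. Otherwise, once `w < b`, the flux `r^M z` is nondecreasing, whence `r² |z| ≤
C` as `M ≥ 2`, and `√E ≤ |z|` because `F < 0`. -/
lemma exists_weightedSpeed_small (h : IsRadialSolution (M + 1) f 0 w z) (h1 : CondH1 f b β)
    (hM : 2 ≤ M) (hnn : ∀ r, 0 ≤ r → 0 ≤ w r) (hw0 : 0 < w 0)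
    (hz : ∀ r, 0 < r → (∀ t ∈ Icc 0 r, 0 < w t) → z r < 0)
    (hlim : Tendsto w atTop (𝓝 0)) {c s₁ : ℝ} (hc : 0 < c) (hs₁ : 0 < s₁) :
    ∃ r, 0 < r ∧ (∀ t ∈ Icc 0 r, 0 < w t) ∧ w r ≤ s₁ ∧ r * √(radialEnergy f w z r) < c := by
  by_cases hzero : ∃ r, 0 ≤ r ∧ w r ≤ 0
  · obtain ⟨R, hR, hwR, hwp⟩ := exists_first_zero h.continuousOn_u hw0 hzero
    have hzR : z R = 0 := by
      refine IsLocalMin.hasDerivAt_eq_zero ?_ (h.hasDerivAt_u hR)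
      filter_upwards [Ioi_mem_nhds hR] with t ht
      rw [hwR]; exact hnn t (le_of_lt ht)
    have hcW : ContinuousAt (fun r => r * √(radialEnergy f w z r)) R :=
      (continuousOn_id.mul (h.continuousOn_radialEnergy h1).sqrt).continuousAt (Ici_mem_nhds hR)
    have hW0 : R * √(radialEnergy f w z R) = 0 := by
      simp [radialEnergy, hzR, hwR, primitiveF_zero]
    have e1 : ∀ᶠ r in 𝓝 R, r * √(radialEnergy f w z r) < c :=
      hcW.eventually (gt_mem_nhds (by simpa only [hW0] using hc))
    have e2 : ∀ᶠ r in 𝓝 R, w r < s₁ :=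
      (h.hasDerivAt_u hR).continuousAt.eventually (gt_mem_nhds (by rwa [hwR]))
    obtain ⟨r, ⟨hr1, hr2⟩, hr3⟩ := (((e1.and e2).filter_mono nhdsWithin_le_nhds).and
      (Ioo_mem_nhdsLT hR)).exists
    exact ⟨r, hr3.1, fun t ht => hwp t ⟨ht.1, ht.2.trans_lt hr3.2⟩, hr2.le, hr1⟩
  · push Not at hzero
    obtain ⟨r₁, hr₁⟩ := (hlim.eventually (gt_mem_nhds h1.b_pos)).exists_forall_of_atTop
    set r₂ := max r₁ 1 with hr₂
    have hr₂1 : 1 ≤ r₂ := le_max_right _ _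
    have hflux : ∀ r, r₂ ≤ r → r₂ ^ M * z r₂ ≤ r ^ M * z r := by
      intro r hr
      refine le_of_hasDerivAt_nonneg (φ := fun t => t ^ M * z t) hr
        (h.continuousOn_flux.mono (fun t ht => by
          have := ht.1; show (0 : ℝ) ≤ t; linarith))
        (fun t ht => h.hasDerivAt_flux le_rfl (by linarith [ht.1])) (fun t ht => ?_)
      have ht0 : 0 < t := by linarith [ht.1]
      have := h1.nonpos_of_le (w t) (hnn t ht0.le) (hr₁ t ((le_max_left _ _).trans ht.1.le)).le
      have := mul_nonpos_of_nonneg_of_nonpos (pow_pos ht0 M).le this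
      linarith
    set C := -(r₂ ^ M * z r₂) with hC
    obtain ⟨r, ⟨hr1, hr2⟩, hr3⟩ := (((eventually_ge_atTop r₂).and
      (hlim.eventually (gt_mem_nhds hs₁))).and (eventually_gt_atTop (C / c))).exists
    have hr0 : 0 < r := by linarith
    refine ⟨r, hr0, fun t ht => hzero t ht.1, hr2.le, ?_⟩
    have hzr := hz r hr0 (fun t ht => hzero t ht.1)
    have hF := h1.primitiveF_neg_of_le_b (hzero r hr0.le)
      (hr₁ r ((le_max_left _ _).trans hr1)).le
    have h3 : √(radialEnergy f w z r) ≤ -z r := by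
      rw [Real.sqrt_le_left (by linarith)]
      simp only [radialEnergy]
      nlinarith
    have h4 : r * (r * -z r) ≤ C := by
      have h5 : r * r ≤ r ^ M := by
        rw [← pow_two]; exact pow_le_pow_right₀ (by linarith) hM
      have := mul_le_mul_of_nonneg_right h5 (show 0 ≤ -z r by linarith)
      linarith [hflux r hr1]
    rw [div_lt_iff₀ hc] at hr3
    have h6 : r * (r * -z r) < r * c := by linarith
    have h7 := lt_of_mul_lt_mul_left h6 hr0.le
    exact (mul_le_mul_of_nonneg_left h3 hr0.le).trans_lt h7

theorem exists_groundState_profile {α : ℝ} (h1 : CondH1 f b β) (h2 : CondH2 (M + 1) f β)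
    (hM : 2 ≤ M) (hα : IsGroundStateValue (M + 1) f α) :
    β < α ∧ ∃ ρ q : ℝ → ℝ, IsHeightProfile M f (Ioo 0 α) ρ q ∧
      (∀ s ∈ Ioo 0 α, 0 < q s ^ 2 + 2 * primitiveF f s) ∧
      (∀ s ∈ Ico β α, 2 * (M + 1) * primitiveF f s < f s * energyRatio f ρ q s) ∧
      ∀ c > 0, ∀ s₁ > 0, ∃ s ∈ Ioc 0 s₁, weightedSpeed f ρ q s < c := by
  obtain ⟨w, z, h, rfl, hz0, hnn, hnc, hlim⟩ := hα
  have hM1 : 1 ≤ M := by omega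
  have hβ := beta_lt_groundStateValue h h1 hM1 hz0 (hnn 0 le_rfl) hnc hlim
  have hw0 : 0 < w 0 := h1.beta_pos.trans hβ
  refine ⟨hβ, ?_⟩
  -- The ground state may reach zero at a finite radius; `I` stops short of it.
  set I : Set ℝ := {r | 0 < r ∧ ∀ t ∈ Icc 0 r, 0 < w t} with hIdef
  have hdown : ∀ r ∈ I, ∀ t, 0 < t → t ≤ r → t ∈ I := fun r hr t ht htr =>
    ⟨ht, fun x hx => hr.2 x ⟨hx.1, hx.2.trans htr⟩⟩
  have hneg : ∀ r ∈ I, z r < 0 := fun r hr =>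
    groundState_deriv_neg h h1 hz0 hβ hlim hr.1 hr.2
  have hanti : StrictAntiOn w I := fun t ht t' ht' hlt =>
    h.strictAnti_of_neg ht.1.le hlt (fun x hx => hneg x (hdown t' ht' x (ht.1.trans hx.1) hx.2.le))
  have hopen : IsOpen I := by
    rw [isOpen_iff_mem_nhds]
    intro r hr
    have := (h.hasDerivAt_u hr.1).continuousAt.eventually (lt_mem_nhds (hr.2 r ⟨hr.1.le, le_rfl⟩))
    obtain ⟨l, u, hlu, hsub⟩ := mem_nhds_iff_exists_Ioo_subset.1 this
    filter_upwards [Ioo_mem_nhds hlu.1 hlu.2, Ioi_mem_nhds hr.1] with t ht ht0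
    refine ⟨ht0, fun x hx => ?_⟩
    rcases le_total x r with hxr | hxr
    · exact hr.2 x ⟨hx.1, hxr⟩
    · exact hsub ⟨hlu.1.trans_le hxr, hx.2.trans_lt ht.2⟩
  have himg : ∀ s ∈ Ioo 0 (w 0), ∃ r ∈ I, w r = s := by
    intro s hs
    obtain ⟨t₀, ht₀, ht₀'⟩ := ((hlim.eventually (gt_mem_nhds hs.1)).and
      (eventually_ge_atTop 0)).exists
    obtain ⟨R, hR, hR0, hRp⟩ := exists_first_zero (φ := fun t => w t - s)
      (h.continuousOn_u.sub continuousOn_const) (sub_pos.2 hs.2) ⟨t₀, ht₀', by linarith⟩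
    refine ⟨R, ⟨hR, fun t ht => ?_⟩, by linarith⟩
    rcases ht.2.eq_or_lt with rfl | hlt
    · linarith [hs.1]
    · linarith [hRp t ⟨ht.1, hlt⟩, hs.1]
  obtain ⟨ρ, q, hprof, hval⟩ := exists_heightProfile (M := M) (f := f) (J := Ioo 0 (w 0)) hopen
    (fun t ht => ht.1) hanti.injOn (fun t ht => h.hasDerivAt_u ht.1)
    (fun t ht => h.hasDerivAt_v ht.1) hneg (fun s hs => himg s hs)
  refine ⟨ρ, q, hprof, ?_, ?_, ?_⟩
  · intro s hs
    obtain ⟨r, hr, rfl⟩ := himg s hs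
    -- Strict positivity: the energy decreases strictly to a later value that is still nonnegative.
    obtain ⟨r', hr', hrr'⟩ : ∃ r' ∈ I, r < r' := by
      obtain ⟨x, hx, hx'⟩ := (((hopen.eventually_mem hr).filter_mono
        (nhdsWithin_le_nhds (s := Ioi r))).and self_mem_nhdsWithin).exists
      exact ⟨x, hx, hx'⟩
    have := h.radialEnergy_lt h1 le_rfl hM1 hr.1.le hrr' (fun _ _ => rfl)
      (fun t ht => hneg t (hdown r' hr' t (hr.1.trans ht.1) ht.2.le))
    have h3 := radialEnergy_nonneg_of_tendsto_zero h h1 hlim hr'.1.le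
    rw [(hval r hr).2, neg_sq]
    exact h3.trans_lt this
  · intro s hs
    obtain ⟨r, hr, rfl⟩ := himg s ⟨h1.beta_pos.trans_le hs.1, hs.2⟩
    have hp := groundState_pohozaev_pos h h1 h2 hM1 hr.1
      (fun t ht => hneg t (hdown r hr t ht.1 ht.2)) hs.1
    have hf := h1.pos_of_gt _ (h1.b_lt_beta.trans_le hs.1)
    have hz' := hneg r hr
    have hrM := pow_pos hr.1 M
    simp only [energyRatio, (hval r hr).1, (hval r hr).2, neg_sq]
    change _ < _ * (r * radialEnergy f w z r / _)
    rw [← mul_div_assoc, lt_div_iff₀ (by linarith)]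
    have h5 : 0 < r ^ M / f (w r) * (f (w r) * (r * radialEnergy f w z r) -
        2 * (M + 1) * primitiveF f (w r) * -z r) := by
      convert hp using 1
      field_simp
      ring
    have := pos_of_mul_pos_right h5 (by positivity)
    linarith
  · intro c hc s₁ hs₁
    obtain ⟨r, hr, hrw, hrs, hrc⟩ := exists_weightedSpeed_small h h1 hM hnn hw0
      (fun r hr hrp => hneg r ⟨hr, hrp⟩) hlim hc hs₁
    refine ⟨w r, ⟨hrw r ⟨hr.le, le_rfl⟩, hrs⟩, ?_⟩
    simpa only [weightedSpeed, (hval r ⟨hr, hrw⟩).1, (hval r ⟨hr, hrw⟩).2, neg_sq,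
      radialEnergy] using hrc

end GroundState

/-! ### Solutions launched steeply from a small radius -/

/-- A solution of `u'' + (k+1)/r u' + g(u) = 0` on `[a, ∞)` with `u(r₀) = α₁`, `u'(r₀) < 0` and
`r₀ u'(r₀) = -K`, where `g = f` on `[0, α₁]`. -/
structure IsLaunched (k : ℕ) (f g : ℝ → ℝ) (α₁ K a r₀ : ℝ) (u v : ℝ → ℝ) : Prop where
  sol : IsRadialSolution (k + 1 + 1) g a u v
  g_eq : ∀ s ∈ Icc 0 α₁, g s = f s
  a_nonneg : 0 ≤ a
  a_le : a ≤ r₀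
  r_pos : 0 < r₀
  u_eq : u r₀ = α₁
  v_neg : v r₀ < 0
  slope : r₀ * v r₀ = -K

namespace IsLaunched
variable {k : ℕ} {f g u v : ℝ → ℝ} {a b β r₀ α₁ K m : ℝ}

lemma continuousOn_u (h : IsLaunched k f g α₁ K a r₀ u v) : ContinuousOn u (Ici r₀) :=
  h.sol.continuousOn_u.mono (Ici_subset_Ici.2 h.a_le)

lemma continuousOn_v (h : IsLaunched k f g α₁ K a r₀ u v) : ContinuousOn v (Ici r₀) :=
  h.sol.continuousOn.mono (Ici_subset_Ici.2 h.a_le)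

lemma continuousOn_flux (h : IsLaunched k f g α₁ K a r₀ u v) :
    ContinuousOn (fun t => t ^ (k + 1) * v t) (Ici r₀) :=
  h.sol.continuousOn_flux.mono (Ici_subset_Ici.2 h.a_le)

lemma hasDerivAt_u (h : IsLaunched k f g α₁ K a r₀ u v) {t : ℝ} (ht : r₀ < t) :
    HasDerivAt u (v t) t := h.sol.hasDerivAt_u (h.a_le.trans_lt ht)

lemma hasDerivAt_flux (h : IsLaunched k f g α₁ K a r₀ u v) {t : ℝ} (ht : r₀ < t)
    (hu : u t ∈ Icc 0 α₁) :
    HasDerivAt (fun t => t ^ (k + 1) * v t) (-(t ^ (k + 1) * f (u t))) t := by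
  rw [← h.g_eq _ hu]
  exact h.sol.hasDerivAt_flux h.a_nonneg (h.a_le.trans_lt ht)

lemma flux_start (h : IsLaunched k f g α₁ K a r₀ u v) :
    r₀ ^ (k + 1) * v r₀ = -(K * r₀ ^ k) := by
  rw [pow_succ, mul_assoc, h.slope]; ring

/-- As long as `u` stays in `(b, α₁]` it keeps decreasing. -/
lemma v_neg_of_gt (h : IsLaunched k f g α₁ K a r₀ u v) (h1 : CondH1 f b β) {R : ℝ}
    (hR : r₀ ≤ R) (hu : ∀ t ∈ Ioo r₀ R, b < u t ∧ u t ≤ α₁) : v R < 0 := by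
  have := le_of_hasDerivAt_nonneg (φ := fun t => -(t ^ (k + 1) * v t)) hR
    (h.continuousOn_flux.neg.mono Icc_subset_Ici_self)
    (fun t ht => (h.hasDerivAt_flux ht.1
      ⟨h1.b_nonneg.trans (hu t ht).1.le, (hu t ht).2⟩).neg)
    (fun t ht => by
      rw [neg_neg]
      exact (mul_pos (pow_pos (h.r_pos.trans ht.1) _) (h1.pos_of_gt _ (hu t ht).1)).le)
  have h2 := mul_neg_of_pos_of_neg (pow_pos h.r_pos (k + 1)) h.v_neg
  have h3 : R ^ (k + 1) * v R < 0 := by linarith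
  exact neg_of_mul_neg_right h3 (pow_pos (h.r_pos.trans_le hR) _).le

/-- Integrates the flux equation with `|f| ≤ m`; the subtracted slope is that of the harmonic
profile carrying the initial flux. -/
lemma abs_v_add_le (h : IsLaunched k f g α₁ K a r₀ u v) (hm0 : 0 ≤ m)
    (hm : ∀ s ∈ Icc 0 α₁, |f s| ≤ m) {R : ℝ} (hR : r₀ ≤ R)
    (hu : ∀ t ∈ Ioo r₀ R, u t ∈ Icc 0 α₁) :
    |v R + K * r₀ ^ k / R ^ (k + 1)| ≤ m * R := by
  have hR0 : 0 < R := h.r_pos.trans_le hR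
  have hpow : ∀ t, HasDerivAt (fun t : ℝ => m * t ^ (k + 1 + 1)) (m * ((k + 2) * t ^ (k + 1))) t :=
    fun t => ((hasDerivAt_pow (k + 1 + 1) t).const_mul m).congr_deriv (by
      rw [Nat.add_sub_cancel]; push_cast; ring)
  have hcp : ContinuousOn (fun t : ℝ => m * t ^ (k + 1 + 1)) (Icc r₀ R) := by fun_prop
  have hcf := h.continuousOn_flux.mono (fun x (hx : x ∈ Icc r₀ R) => hx.1)
  have hbd : ∀ t ∈ Ioo r₀ R, |t ^ (k + 1) * f (u t)| ≤ m * ((k + 2) * t ^ (k + 1)) := by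
    intro t ht
    have ht0 := pow_pos (h.r_pos.trans ht.1) (k + 1)
    have := hm _ (hu t ht)
    rw [abs_mul, abs_of_pos ht0]
    have hk : (0 : ℝ) ≤ k := k.cast_nonneg
    have h3 : 0 ≤ m * ((k + 1) * t ^ (k + 1)) := by positivity
    nlinarith
  have e1 := le_of_hasDerivAt_nonneg (φ := fun t => t ^ (k + 1) * v t + m * t ^ (k + 1 + 1)) hR
    (hcf.add hcp) (fun t ht => (h.hasDerivAt_flux ht.1 (hu t ht)).add (hpow t))
    (fun t ht => by linarith [(abs_le.1 (hbd t ht)).2])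
  have e2 := le_of_hasDerivAt_nonneg (φ := fun t => m * t ^ (k + 1 + 1) - t ^ (k + 1) * v t) hR
    (hcp.sub hcf) (fun t ht => (hpow t).sub (h.hasDerivAt_flux ht.1 (hu t ht)))
    (fun t ht => by linarith [(abs_le.1 (hbd t ht)).1])
  have hr0 : 0 ≤ m * r₀ ^ (k + 1 + 1) := mul_nonneg hm0 (pow_pos h.r_pos _).le
  simp only [h.flux_start] at e1 e2
  have hP := pow_pos hR0 (k + 1)
  have hv : v R + K * r₀ ^ k / R ^ (k + 1) = (R ^ (k + 1) * v R + K * r₀ ^ k) / R ^ (k + 1) := by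
    field_simp
  rw [hv, abs_div, abs_of_pos hP, div_le_iff₀ hP, abs_le]
  have : m * R * R ^ (k + 1) = m * R ^ (k + 1 + 1) := by ring
  constructor <;> linarith

lemma abs_u_sub_le (h : IsLaunched k f g α₁ K a r₀ u v) (hk : 1 ≤ k) (hm0 : 0 ≤ m)
    (hm : ∀ s ∈ Icc 0 α₁, |f s| ≤ m) {R : ℝ} (hR : r₀ ≤ R)
    (hu : ∀ t ∈ Ioo r₀ R, u t ∈ Icc 0 α₁) :
    |u R - ((α₁ - K / k) + K / k * (r₀ / R) ^ k)| ≤ m * R ^ 2 := by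
  have hk0 : (k : ℝ) ≠ 0 := by positivity
  have hr0 := h.r_pos
  have hpos : ∀ t, r₀ ≤ t → t ≠ 0 := fun t ht => (hr0.trans_le ht).ne'
  have hA : ∀ t, r₀ ≤ t → HasDerivAt (fun t : ℝ => (α₁ - K / k) + K / k * (r₀ / t) ^ k)
      (-(K * r₀ ^ k / t ^ (k + 1))) t := by
    intro t ht
    have ht0 := hpos t ht
    refine ((((((hasDerivAt_id t).inv ht0).const_mul r₀).pow k).const_mul (K / k)).const_add
      (α₁ - K / k)).congr_deriv ?_
    obtain ⟨j, rfl⟩ : ∃ j, k = j + 1 := ⟨k - 1, by omega⟩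
    simp only [id, Nat.add_sub_cancel, mul_pow, inv_pow, pow_succ, Pi.inv_apply]
    field_simp
  have hsq : ∀ t, HasDerivAt (fun t : ℝ => m * t ^ 2) (m * (2 * t)) t := fun t =>
    ((hasDerivAt_pow 2 t).const_mul m).congr_deriv (by simp)
  have hcs : ContinuousOn (fun t : ℝ => m * t ^ 2) (Icc r₀ R) := by fun_prop
  have hcA : ContinuousOn (fun t : ℝ => (α₁ - K / k) + K / k * (r₀ / t) ^ k) (Icc r₀ R) :=
    fun t ht => (hA t ht.1).continuousAt.continuousWithinAt
  have hcu := h.continuousOn_u.mono (fun x (hx : x ∈ Icc r₀ R) => hx.1)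
  have hbd : ∀ t ∈ Ioo r₀ R, |v t + K * r₀ ^ k / t ^ (k + 1)| ≤ m * (2 * t) := fun t ht => by
    have := h.abs_v_add_le hm0 hm ht.1.le (fun x hx => hu x ⟨hx.1, hx.2.trans ht.2⟩)
    have h3 : 0 ≤ m * t := mul_nonneg hm0 (hr0.trans ht.1).le
    linarith
  have e1 := le_of_hasDerivAt_nonneg
    (φ := fun t => (u t - ((α₁ - K / k) + K / k * (r₀ / t) ^ k)) + m * t ^ 2) hR
    ((hcu.sub hcA).add hcs)
    (fun t ht => ((h.hasDerivAt_u ht.1).sub (hA t ht.1.le)).add (hsq t))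
    (fun t ht => by linarith [(abs_le.1 (hbd t ht)).1])
  have e2 := le_of_hasDerivAt_nonneg
    (φ := fun t => m * t ^ 2 - (u t - ((α₁ - K / k) + K / k * (r₀ / t) ^ k))) hR
    (hcs.sub (hcu.sub hcA))
    (fun t ht => (hsq t).sub ((h.hasDerivAt_u ht.1).sub (hA t ht.1.le)))
    (fun t ht => by linarith [(abs_le.1 (hbd t ht)).2])
  have hs : 0 ≤ m * r₀ ^ 2 := by positivity
  simp only [h.u_eq, div_self hr0.ne', one_pow, mul_one, sub_add_cancel, sub_self] at e1 e2
  rw [abs_le]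
  constructor <;> linarith

/-- The harmonic part of the slope points downwards, so only the source can lift `u`. -/
lemma u_le_add (h : IsLaunched k f g α₁ K a r₀ u v) (hK : 0 ≤ K) (hm0 : 0 ≤ m)
    (hm : ∀ s ∈ Icc 0 α₁, |f s| ≤ m) {t R : ℝ} (ht : r₀ ≤ t) (htR : t ≤ R)
    (hu : ∀ t ∈ Ioo r₀ R, u t ∈ Icc 0 α₁) : u R ≤ u t + m * R ^ 2 := by
  have hsq : ∀ t, HasDerivAt (fun t : ℝ => m * t ^ 2) (m * (2 * t)) t := fun t =>
    ((hasDerivAt_pow 2 t).const_mul m).congr_deriv (by simp)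
  have hcs : ContinuousOn (fun t : ℝ => m * t ^ 2) (Icc t R) := by fun_prop
  have e := le_of_hasDerivAt_nonneg (φ := fun t => m * t ^ 2 - u t) htR
    (hcs.sub (h.continuousOn_u.mono (fun x hx => ht.trans hx.1)))
    (fun x hx => (hsq x).sub (h.hasDerivAt_u (ht.trans_lt hx.1)))
    (fun x hx => by
      have hx0 := ht.trans_lt hx.1
      have := (abs_le.1 (h.abs_v_add_le hm0 hm hx0.le
        (fun y hy => hu y ⟨hy.1, hy.2.trans hx.2⟩))).2
      have hx0' := h.r_pos.trans hx0
      have h3 : 0 ≤ m * x := by positivity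
      have h4 : 0 ≤ K * r₀ ^ k / x ^ (k + 1) := by
        have := h.r_pos
        positivity
      linarith)
  have : 0 ≤ m * t ^ 2 := by positivity
  linarith

/-- Exit through `0` contradicts closeness to the harmonic profile, which stays above `α₁ - K/k`.
Exit through `α₁` is impossible if `u` stayed above `b`, since it then decreases; if it dipped to
`b`, there is no time to climb back by `α₁ - b`. -/
lemma u_mem_Ioo (h : IsLaunched k f g α₁ K a r₀ u v) (h1 : CondH1 f b β) (hk : 1 ≤ k)
    (hK : 0 ≤ K) (hm0 : 0 ≤ m) (hm : ∀ s ∈ Icc 0 α₁, |f s| ≤ m) {ε : ℝ}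
    (hα : 0 < α₁) (hε0 : m * ε ^ 2 < α₁ - K / k) (hεb : m * ε ^ 2 < α₁ - b) :
    ∀ t ∈ Ioc r₀ ε, u t ∈ Ioo 0 α₁ := by
  intro t ht
  -- The exit argument starts at `r₁ > r₀` because `u` sits on the boundary value `α₁` at `r₀`.
  obtain ⟨r₁, hr₁, hlt⟩ : ∃ r₁ ∈ Ioo r₀ t, ∀ x ∈ Icc r₀ r₁, 0 < u x ∧ v x < 0 := by
    have e1 : ∀ᶠ x in 𝓝[≥] r₀, 0 < u x :=
      (h.continuousOn_u r₀ self_mem_Ici).eventually (lt_mem_nhds (by rwa [h.u_eq]))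
    have e2 : ∀ᶠ x in 𝓝[≥] r₀, v x < 0 :=
      (h.continuousOn_v r₀ self_mem_Ici).eventually (gt_mem_nhds h.v_neg)
    obtain ⟨η, hη, hs⟩ := (mem_nhdsGE_iff_exists_Icc_subset.1 (e1.and e2))
    refine ⟨min η ((r₀ + t) / 2), ⟨lt_min hη (by linarith [ht.1]),
      (min_le_right _ _).trans_lt (by linarith [ht.1])⟩, fun x hx => ?_⟩
    exact hs ⟨hx.1, hx.2.trans (min_le_left _ _)⟩
  have hdec : ∀ x ∈ Ioc r₀ r₁, u x ∈ Ioo 0 α₁ := by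
    intro x hx
    refine ⟨(hlt x (Ioc_subset_Icc_self hx)).1, ?_⟩
    rw [← h.u_eq]
    exact h.sol.strictAnti_of_neg h.a_le hx.1 (fun y hy => (hlt y ⟨hy.1.le, hy.2.le.trans hx.2⟩).2)
  by_contra hcon
  have hmin : ∀ x, 0 < min (u x) (α₁ - u x) ↔ u x ∈ Ioo 0 α₁ := fun x => by
    simp
  obtain ⟨R, hR, hR0, hRp⟩ := exists_first_zero (φ := fun x => min (u x) (α₁ - u x)) (a := r₁)
    (((h.continuousOn_u).inf (continuousOn_const.sub h.continuousOn_u)).mono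
      (Ici_subset_Ici.2 hr₁.1.le))
    ((hmin _).2 (hdec r₁ ⟨hr₁.1, le_rfl⟩))
    ⟨t, hr₁.2.le, by rw [← not_lt, hmin]; exact hcon⟩
  have hRt : R ≤ t := by
    by_contra! hlt'
    exact hcon ((hmin t).1 (hRp t ⟨hr₁.2.le, hlt'⟩))
  have hr₀R : r₀ < R := hr₁.1.trans hR
  have hin : ∀ x ∈ Ioo r₀ R, u x ∈ Ioo 0 α₁ := by
    intro x hx
    rcases le_total x r₁ with hx1 | hx1
    · exact hdec x ⟨hx.1, hx1⟩
    · exact (hmin x).1 (hRp x ⟨hx1, hx.2⟩)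
  have hin' : ∀ x ∈ Ioo r₀ R, u x ∈ Icc 0 α₁ := fun x hx => Ioo_subset_Icc_self (hin x hx)
  have hR00 : 0 < R := h.r_pos.trans hr₀R
  have hmR : m * R ^ 2 ≤ m * ε ^ 2 := by
    have : R ≤ ε := hRt.trans ht.2
    gcongr
  have hcase : u R = 0 ∨ u R = α₁ := by
    rcases min_choice (u R) (α₁ - u R) with hc | hc <;> rw [hc] at hR0
    · exact Or.inl hR0
    · exact Or.inr (by linarith)
  rcases hcase with hc | hc
  · have := (abs_le.1 (h.abs_u_sub_le hk hm0 hm hr₀R.le hin')).1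
    have h3 : 0 ≤ K / k * (r₀ / R) ^ k := by
      have := h.r_pos
      positivity
    linarith
  · by_cases hb : ∀ x ∈ Ioo r₀ R, b < u x
    · have : u R < u r₀ := h.sol.strictAnti_of_neg h.a_le hr₀R (fun x hx =>
        h.v_neg_of_gt h1 hx.1.le (fun y hy =>
          ⟨hb y ⟨hy.1, hy.2.trans hx.2⟩, (hin y ⟨hy.1, hy.2.trans hx.2⟩).2.le⟩))
      rw [hc, h.u_eq] at this
      exact lt_irrefl _ this
    · push Not at hb
      obtain ⟨x, hx, hxb⟩ := hb
      have := h.u_le_add hK hm0 hm hx.1.le hx.2.le hin'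
      linarith

end IsLaunched

/-- Launched solutions arrive near `α₁ - K/k` with small slope, uniformly as `r₀ → 0`. -/
lemma exists_arrival {k : ℕ} {f : ℝ → ℝ} {b β α₁ K : ℝ} (h1 : CondH1 f b β) (hk : 1 ≤ k)
    (hb : b < α₁) (hK : 0 < K) (hα₀ : 0 < α₁ - K / k) {κ τ : ℝ} (hκ : 0 < κ)
    (hτ : τ ∈ Ioo (0 : ℝ) 1) :
    ∃ ε > 0, ε ≤ 1 ∧ ∃ δ > 0, ∀ (g u v : ℝ → ℝ) (a r₀ : ℝ), r₀ < δ →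
      IsLaunched k f g α₁ K a r₀ u v → r₀ < τ * ε ∧ (∀ t ∈ Ioc r₀ ε, u t ∈ Ioo 0 α₁) ∧
        (∀ t ∈ Icc r₀ ε, α₁ - K / k - κ ≤ u t) ∧
        (∀ t ∈ Icc (τ * ε) ε, u t ≤ α₁ - K / k + κ) ∧ |v ε| ≤ κ := by
  have hα : 0 < α₁ := h1.b_pos.trans hb
  obtain ⟨m, hm⟩ : ∃ m, ∀ s ∈ Icc 0 α₁, |f s| ≤ m := by
    obtain ⟨m, hm⟩ := (isCompact_Icc (a := (0 : ℝ)) (b := α₁)).exists_bound_of_continuousOn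
      h1.continuous.continuousOn
    exact ⟨m, hm⟩
  have hm0 : 0 ≤ m := (abs_nonneg _).trans (hm 0 ⟨le_rfl, hα.le⟩)
  obtain ⟨ε, hε, hε1, hεm⟩ : ∃ ε > 0, ε ≤ 1 ∧ m * ε < min (min (α₁ - K / k) (α₁ - b)) (κ / 2) := by
    have hpos : 0 < min (min (α₁ - K / k) (α₁ - b)) (κ / 2) :=
      lt_min (lt_min hα₀ (by linarith)) (by linarith)
    have hl : Tendsto (fun ε : ℝ => m * ε) (𝓝[>] 0) (𝓝 0) := by
      have : Continuous (fun ε : ℝ => m * ε) := by fun_prop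
      simpa using (this.tendsto 0).mono_left nhdsWithin_le_nhds
    obtain ⟨ε, h3, h4⟩ := ((hl.eventually (gt_mem_nhds hpos)).and
      (Ioc_mem_nhdsGT (zero_lt_one (α := ℝ)))).exists
    exact ⟨ε, h4.1, h4.2, h3⟩
  have hεm2 : m * ε ^ 2 ≤ m * ε := by
    have : ε ^ 2 ≤ ε := by nlinarith
    gcongr
  have hc1 : m * ε < α₁ - K / k :=
    hεm.trans_le ((min_le_left _ _).trans (min_le_left _ _))
  have hc2 : m * ε < α₁ - b := hεm.trans_le ((min_le_left _ _).trans (min_le_right _ _))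
  have hc3 : m * ε < κ / 2 := hεm.trans_le (min_le_right _ _)
  have hτε : 0 < τ * ε := mul_pos hτ.1 hε
  have hτε' : τ * ε ≤ ε := by nlinarith [hτ.2]
  have hk0 : k ≠ 0 := by omega
  -- With `ε` fixed, letting `r₀ → 0` removes the harmonic remainder on `[τε, ε]` and its slope at
  -- `ε`.
  have ev : ∀ᶠ r₀ in 𝓝[>] (0 : ℝ), r₀ < τ * ε ∧ K / k * (r₀ / (τ * ε)) ^ k < κ / 2 ∧
      K * r₀ ^ k / ε ^ (k + 1) < κ / 2 := by
    have l1 : Tendsto (fun r : ℝ => K / k * (r / (τ * ε)) ^ k) (𝓝[>] 0) (𝓝 0) := by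
      have : Continuous (fun r : ℝ => K / k * (r / (τ * ε)) ^ k) := by fun_prop
      simpa [hk0] using (this.tendsto 0).mono_left nhdsWithin_le_nhds
    have l2 : Tendsto (fun r : ℝ => K * r ^ k / ε ^ (k + 1)) (𝓝[>] 0) (𝓝 0) := by
      have : Continuous (fun r : ℝ => K * r ^ k / ε ^ (k + 1)) := by fun_prop
      simpa [hk0] using (this.tendsto 0).mono_left nhdsWithin_le_nhds
    have hκ2 : 0 < κ / 2 := by linarith
    filter_upwards [Ioo_mem_nhdsGT hτε, l1.eventually (gt_mem_nhds hκ2),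
      l2.eventually (gt_mem_nhds hκ2)] with r e1 e2 e3 using ⟨e1.2, e2, e3⟩
  obtain ⟨δ, hδ, hδs⟩ := mem_nhdsGT_iff_exists_Ioo_subset.1 ev
  refine ⟨ε, hε, hε1, δ, hδ, fun g u v a r₀ hr₀ h => ?_⟩
  obtain ⟨c1, c2, c3⟩ := hδs ⟨h.r_pos, hr₀⟩
  have hr₀ε : r₀ < ε := c1.trans_le hτε'
  have hin := h.u_mem_Ioo h1 hk hK.le hm0 hm hα (hεm2.trans_lt hc1) (hεm2.trans_lt hc2)
  have hest : ∀ t ∈ Icc r₀ ε, |u t - ((α₁ - K / k) + K / k * (r₀ / t) ^ k)| ≤ κ / 2 := by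
    intro t ht
    have h3 := h.abs_u_sub_le hk hm0 hm ht.1
      (fun x hx => Ioo_subset_Icc_self (hin x ⟨hx.1, hx.2.le.trans ht.2⟩))
    have h4 : m * t ^ 2 ≤ m * ε ^ 2 := by
      have := h.r_pos.trans_le ht.1
      have := ht.2
      gcongr
    linarith
  refine ⟨c1, hin, fun t ht => ?_, fun t ht => ?_, ?_⟩
  · have := (abs_le.1 (hest t ht)).1
    have h3 : 0 ≤ K / k * (r₀ / t) ^ k := by
      have := h.r_pos
      have := h.r_pos.trans_le ht.1
      positivity
    linarith
  · have := (abs_le.1 (hest t ⟨c1.le.trans ht.1, ht.2⟩)).2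
    have h3 : K / k * (r₀ / t) ^ k ≤ K / k * (r₀ / (τ * ε)) ^ k := by
      have := h.r_pos
      have := ht.1
      have := hτε.trans_le ht.1
      gcongr
    linarith
  · have h3 := h.abs_v_add_le hm0 hm hr₀ε.le
      (fun x hx => Ioo_subset_Icc_self (hin x ⟨hx.1, hx.2.le⟩))
    have h4 : 0 ≤ K * r₀ ^ k / ε ^ (k + 1) := by
      have := h.r_pos
      positivity
    rw [abs_le] at h3 ⊢
    constructor <;> linarith [h3.1, h3.2]

/-! ### Trapping by negative energy, and contradiction with the ground state -/

namespace IsRadialSolution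
variable {M : ℕ} {f g u v : ℝ → ℝ} {a b β α₁ : ℝ}

/-- Once the energy is negative, the solution is trapped in a compact subset of `(0, β)`. -/
lemma exists_lower_bound (h : IsRadialSolution (M + 1) g a u v) (h1 : CondH1 f b β) (ha : 0 ≤ a)
    (hg : ∀ s ∈ Icc 0 α₁, g s = f s) (hβ : β < α₁) {r₁ : ℝ} (har : a ≤ r₁) (hu : 0 < u r₁)
    (hE : radialEnergy f u v r₁ < 0) : ∃ c > 0, ∀ r, r₁ ≤ r → c ≤ u r := by
  have huβ : u r₁ < β := by
    by_contra! hle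
    have := h1.primitiveF_nonneg hle
    have := sq_nonneg (v r₁)
    simp only [radialEnergy] at hE
    linarith
  -- Both ends of `(c, β)` are barriers: reaching either would need more energy than is available.
  obtain ⟨c, hFc, hc⟩ : ∃ c, radialEnergy f u v r₁ < 2 * primitiveF f c ∧ c ∈ Ioo 0 (u r₁) := by
    have hl : Tendsto (fun c => 2 * primitiveF f c) (𝓝[>] 0) (𝓝 0) := by
      simpa [primitiveF_zero] using
        ((h1.continuous_primitiveF.tendsto 0).const_mul 2).mono_left nhdsWithin_le_nhds
    exact ((hl.eventually (lt_mem_nhds hE)).and (Ioo_mem_nhdsGT hu)).exists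
  refine ⟨c, hc.1, fun r hr => ?_⟩
  by_contra! hlt
  have hcu := h.continuousOn_u.mono (Ici_subset_Ici.2 har)
  obtain ⟨R, hR, hR0, hRp⟩ := exists_first_zero (φ := fun t => min (u t - c) (β - u t))
    ((hcu.sub continuousOn_const).inf (continuousOn_const.sub hcu))
    (lt_min (sub_pos.2 hc.2) (sub_pos.2 huβ)) ⟨r, hr, (min_le_left _ _).trans (by linarith)⟩
  have hER := h.radialEnergy_le h1 ha har hR.le (fun t ht => by
    have := lt_min_iff.1 (hRp t ⟨ht.1.le, ht.2⟩)
    exact hg _ ⟨by linarith [hc.1], by linarith⟩)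
  have hF : 2 * primitiveF f (u R) ≤ radialEnergy f u v R := by
    have := sq_nonneg (v R)
    simp only [radialEnergy]
    linarith
  rcases min_choice (u R - c) (β - u R) with hm | hm <;> rw [hm] at hR0
  · rw [sub_eq_zero.1 hR0] at hF
    linarith
  · rw [← sub_eq_zero.1 hR0, h1.primitive_beta] at hF
    linarith

/-- A positive decreasing solution with nonnegative energy tends to `0`. -/
lemma tendsto_zero_of_energy_nonneg (h : IsRadialSolution (M + 1) g a u v) (h1 : CondH1 f b β)
    (ha : 0 ≤ a) {ε : ℝ} (hε : a < ε) (hg : ∀ r, ε ≤ r → g (u r) = f (u r))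
    (hu : ∀ r, ε ≤ r → 0 < u r) (hv : ∀ r, ε ≤ r → v r < 0)
    (hE : ∀ r, ε ≤ r → 0 ≤ radialEnergy f u v r) : Tendsto u atTop (𝓝 0) := by
  have hε0 : 0 < ε := ha.trans_lt hε
  have hanti : ∀ r r', ε ≤ r → r ≤ r' → u r' ≤ u r := fun r r' hr hrr' => by
    rcases hrr'.eq_or_lt with rfl | hlt
    · exact le_rfl
    · exact (h.strictAnti_of_neg (hε.le.trans hr) hlt (fun t ht => hv t (hr.trans ht.1.le))).le
  have hU : Antitone (fun t => u (max ε t)) := fun t t' htt' =>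
    hanti _ _ (le_max_left _ _) (max_le_max le_rfl htt')
  have hUb : BddBelow (range fun t => u (max ε t)) :=
    ⟨0, by rintro _ ⟨t, rfl⟩; exact (hu _ (le_max_left _ _)).le⟩
  set l := ⨅ t, u (max ε t)
  have hle : ∀ r, ε ≤ r → l ≤ u r := fun r hr => by
    have := ciInf_le hUb r
    rwa [max_eq_right hr] at this
  have hl0 : 0 ≤ l := le_ciInf fun t => (hu _ (le_max_left _ _)).le
  have hlim : Tendsto u atTop (𝓝 l) := by
    refine (tendsto_atTop_ciInf hU hUb).congr' ?_
    filter_upwards [eventually_ge_atTop ε] with t ht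
    rw [max_eq_right ht]
  rcases hl0.eq_or_lt with hl | hl
  · rwa [← hl] at hlim
  exfalso
  -- the slope comes arbitrarily close to zero
  have hslope : ∀ η > 0, ∀ T, ε ≤ T → ∃ x, T ≤ x ∧ -η < v x := by
    intro η hη T hT
    have hd : Tendsto (fun t => u (t + 1) - u t) atTop (𝓝 0) := by
      simpa using (hlim.comp (tendsto_atTop_add_const_right _ 1 tendsto_id)).sub hlim
    obtain ⟨t, ht, hTt⟩ := ((hd.eventually (lt_mem_nhds (neg_lt_zero.2 hη))).and
      (eventually_ge_atTop T)).exists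
    obtain ⟨x, hx, hx'⟩ := exists_hasDerivAt_eq_slope u v (show t < t + 1 by linarith)
      (h.continuousOn_u.mono (fun y hy => by
        have := hy.1
        show a ≤ y
        linarith)) (fun y hy => h.hasDerivAt_u (by linarith [hy.1]))
    refine ⟨x, hTt.trans hx.1.le, ?_⟩
    rw [hx', add_sub_cancel_left, div_one]
    exact ht
  -- Nonnegative energy along radii where the slope tends to zero gives `F(l) ≥ 0`, so a positive
  -- limit lies at or above `β`.
  have hFl : 0 ≤ primitiveF f l := by
    by_contra! hneg
    have hev := ((h1.continuous_primitiveF.tendsto l).comp hlim).eventually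
      (gt_mem_nhds (show primitiveF f l < primitiveF f l / 2 by linarith))
    obtain ⟨T, hT⟩ := hev.exists_forall_of_atTop
    obtain ⟨x, hx, hx'⟩ := hslope (√(-primitiveF f l)) (Real.sqrt_pos.2 (by linarith))
      (max ε T) (le_max_left _ _)
    have h3 := hE x ((le_max_left _ _).trans hx)
    have h4 := hT x ((le_max_right _ _).trans hx)
    have h5 := hv x ((le_max_left _ _).trans hx)
    have h6 : v x ^ 2 < -primitiveF f l := by
      rw [← Real.sq_sqrt (show 0 ≤ -primitiveF f l by linarith), ← neg_sq]
      exact pow_lt_pow_left₀ (by linarith) (by linarith) two_ne_zero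
    simp only [radialEnergy, Function.comp_apply] at h3 h4
    linarith
  have hlβ : β ≤ l := by
    by_contra! hlt
    linarith [h1.primitiveF_neg hl hlt]
  obtain ⟨c₀, hc₀, hfc⟩ : ∃ c₀ > 0, ∀ s ∈ Icc l (u ε), c₀ ≤ f s := by
    obtain ⟨x, hx, hmin⟩ := (isCompact_Icc (a := l) (b := u ε)).exists_isMinOn
      ⟨l, le_rfl, hle ε le_rfl⟩ h1.continuous.continuousOn
    exact ⟨f x, h1.pos_of_gt x (h1.b_lt_beta.trans_le (hlβ.trans hx.1)), fun s hs => hmin hs⟩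
  -- Since `f ≥ c₀`, the flux grows at least like `c₀ r^(M+1)/(M+1)`. For `x ≥ 2ε` one has `x^(M+1)
  -- - ε^(M+1) ≥ ε x^M`, so the slope is at least `c₀ ε/(M+1)` in size.
  obtain ⟨x, hx, hx'⟩ := hslope (c₀ * ε / (M + 1)) (by positivity) (2 * ε) (by linarith)
  have hεx : ε ≤ x := by linarith
  have hpow : ∀ t, HasDerivAt (fun t : ℝ => c₀ / (M + 1) * t ^ (M + 1)) (c₀ * t ^ M) t := fun t =>
    ((hasDerivAt_pow (M + 1) t).const_mul (c₀ / (M + 1))).congr_deriv (by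
      have : (M : ℝ) + 1 ≠ 0 := by positivity
      push_cast
      field_simp)
  have e := le_of_hasDerivAt_nonneg
    (φ := fun t => -(t ^ M * v t) - c₀ / (M + 1) * t ^ (M + 1)) hεx
    ((h.continuousOn_flux.neg.mono (fun t ht => hε.le.trans ht.1)).sub
      (Continuous.continuousOn (by fun_prop)))
    (fun t ht => (h.hasDerivAt_flux ha (hε.trans ht.1)).neg.sub (hpow t))
    (fun t ht => by
      rw [neg_neg, hg t ht.1.le]
      have h3 := hfc (u t) ⟨hle t ht.1.le, hanti ε t le_rfl ht.1.le⟩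
      have h4 := mul_le_mul_of_nonneg_left h3 (pow_pos (hε0.trans ht.1) M).le
      linarith)
  have hvε := mul_neg_of_pos_of_neg (pow_pos hε0 M) (hv ε le_rfl)
  have hxM := pow_pos (hε0.trans_le hεx) M
  have hεM : ε ^ M ≤ x ^ M := pow_le_pow_left₀ hε0.le hεx M
  have h5 : ε ^ (M + 1) + ε * x ^ M ≤ x ^ (M + 1) := by
    rw [pow_succ, pow_succ]
    nlinarith
  have hcM : 0 < c₀ / ((M : ℝ) + 1) := by positivity
  have h6 := mul_le_mul_of_nonneg_left h5 hcM.le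
  have h7 : x ^ M * (c₀ * ε / (M + 1)) ≤ x ^ M * -v x := by
    have : x ^ M * (c₀ * ε / (M + 1)) = c₀ / (M + 1) * (ε * x ^ M) := by ring
    linarith
  linarith [le_of_mul_le_mul_left h7 hxM]

/-- A solution starting below the ground state with smaller slope and smaller energy ratio reaches
negative energy while still positive. -/
lemma exists_radialEnergy_neg (h : IsRadialSolution (M + 1) g a u v) (h1 : CondH1 f b β)
    (hM : 1 ≤ M) (ha : 0 ≤ a) (hg : ∀ s ∈ Icc 0 α₁, g s = f s) {α : ℝ} {ρ q : ℝ → ℝ}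
    (hw : IsHeightProfile M f (Ioo 0 α) ρ q)
    (hT : ∀ s ∈ Ico β α, 2 * (M + 1) * primitiveF f s < f s * energyRatio f ρ q s)
    (hsmall : ∀ c > 0, ∀ s₁ > 0, ∃ s ∈ Ioc 0 s₁, weightedSpeed f ρ q s < c)
    {r₀ ε : ℝ} (har : a ≤ r₀) (hε : r₀ < ε) (hu : ∀ t ∈ Ioc r₀ ε, u t ∈ Ioo 0 α₁)
    (hv : ∀ t ∈ Ioc r₀ ε, v t < 0) (hα : u ε < α) (hpq : -v ε < q (u ε))
    (hG : β ≤ u ε → ε * radialEnergy f u v ε / -v ε < energyRatio f ρ q (u ε))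
    (hW : u ε ≤ β → ε * √(radialEnergy f u v ε) < weightedSpeed f ρ q (u ε)) :
    ∃ R, ε ≤ R ∧ (∀ t ∈ Icc ε R, 0 < u t) ∧ radialEnergy f u v R < 0 := by
  by_contra! hcon
  have haε : a < ε := har.trans_lt hε
  have hεm : ε ∈ Ioc r₀ ε := ⟨hε, le_rfl⟩
  -- Starting at `r₀` rather than `ε` makes `ε` an interior point, so the profile is differentiable
  -- at its top height `u ε`.
  set I : Set ℝ := {r | r₀ < r ∧ ∀ t ∈ Icc ε r, 0 < u t ∧ v t < 0} with hIdef
  have hdown : ∀ r ∈ I, ∀ t, r₀ < t → t ≤ r → t ∈ I := fun r hr t ht htr =>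
    ⟨ht, fun x hx => hr.2 x ⟨hx.1, hx.2.trans htr⟩⟩
  have huv : ∀ r ∈ I, 0 < u r ∧ v r < 0 := fun r hr => by
    rcases le_total r ε with hrε | hrε
    · exact ⟨(hu r ⟨hr.1, hrε⟩).1, hv r ⟨hr.1, hrε⟩⟩
    · exact hr.2 r ⟨hrε, le_rfl⟩
  have hanti : StrictAntiOn u I := fun t ht t' ht' hlt =>
    h.strictAnti_of_neg (har.trans ht.1.le) hlt
      (fun x hx => (huv x (hdown t' ht' x (ht.1.trans hx.1) hx.2.le)).2)
  have hεI : ε ∈ I := ⟨hε, fun t ht => by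
    rw [le_antisymm ht.2 ht.1]; exact ⟨(hu ε hεm).1, hv ε hεm⟩⟩
  have huα : ∀ r ∈ I, u r < α₁ := fun r hr => by
    rcases le_total r ε with hrε | hrε
    · exact (hu r ⟨hr.1, hrε⟩).2
    · exact (hanti.antitoneOn hεI hr hrε).trans_lt (hu ε hεm).2
  have hgI : ∀ r ∈ I, g (u r) = f (u r) := fun r hr => hg _ ⟨(huv r hr).1.le, (huα r hr).le⟩
  have hEI : ∀ r ∈ I, ε ≤ r → 0 ≤ radialEnergy f u v r := fun r hr hεr =>
    hcon r hεr (fun t ht => (hr.2 t ht).1)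
  have hopen : IsOpen I := by
    rw [isOpen_iff_mem_nhds]
    intro r hr
    have har' : a < r := har.trans_lt hr.1
    have e1 := (h.hasDerivAt_u har').continuousAt.eventually (lt_mem_nhds (huv r hr).1)
    have e2 := (h.hasDerivAt_v har').continuousAt.eventually (gt_mem_nhds (huv r hr).2)
    obtain ⟨l, y, hly, hsub⟩ := mem_nhds_iff_exists_Ioo_subset.1 (e1.and e2)
    filter_upwards [Ioo_mem_nhds hly.1 hly.2, Ioi_mem_nhds hr.1] with t ht ht0
    refine ⟨ht0, fun x hx => ?_⟩
    rcases le_total x r with hxr | hxr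
    · exact hr.2 x ⟨hx.1, hxr⟩
    · exact hsub ⟨hly.1.trans_le hxr, hx.2.trans_lt ht.2⟩
  have hcu := h.continuousOn_u.mono (Ici_subset_Ici.2 haε.le)
  have hcv := h.continuousOn.mono (Ici_subset_Ici.2 haε.le)
  -- Under the contradiction hypothesis every lower height is attained: either `u` first fails by
  -- reaching zero, a turning point being excluded by its negative energy, or it decreases forever
  -- and tends to `0`.
  have himg : ∀ s ∈ Ioc 0 (u ε), ∃ r ∈ I, ε ≤ r ∧ u r = s := by
    intro s hs
    by_cases hz : ∃ r, ε ≤ r ∧ min (u r) (-v r) ≤ 0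
    · obtain ⟨R, hR, hR0, hRp⟩ := exists_first_zero (φ := fun t => min (u t) (-v t))
        (hcu.inf hcv.neg) (lt_min (hu ε hεm).1 (by linarith [hv ε hεm])) hz
      have hRp' : ∀ t ∈ Ico ε R, 0 < u t ∧ v t < 0 := fun t ht => by
        have := lt_min_iff.1 (hRp t ht)
        exact ⟨this.1, by linarith⟩
      have hRI : ∀ t ∈ Ico ε R, t ∈ I := fun t ht =>
        ⟨hε.trans_le ht.1, fun x hx => hRp' x ⟨hx.1, hx.2.trans_lt ht.2⟩⟩
      have huR : u R = 0 := by
        rcases min_choice (u R) (-v R) with hm | hm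
        · rwa [hm] at hR0
        · have huR0 : 0 ≤ u R := hR0.symm.le.trans (min_le_left _ _)
          rw [hm] at hR0
          rcases huR0.eq_or_lt with h0 | h0
          · exact h0.symm
          exfalso
          have hlt : u R < u ε := h.strictAnti_of_neg haε.le hR
            (fun t ht => (hRp' t ⟨ht.1.le, ht.2⟩).2)
          have := h.radialEnergy_neg_of_turning h1 haε.le hR (fun t ht => (hRp' t ht).2)
            (by linarith) h0 (hg _ ⟨h0.le, (hlt.trans (hu ε hεm).2).le⟩)
          have h3 := hcon R hR.le (fun t ht => by
            rcases ht.2.eq_or_lt with rfl | h4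
            · exact h0
            · exact (hRp' t ⟨ht.1, h4⟩).1)
          linarith
      obtain ⟨t, ht, hts⟩ := intermediate_value_Icc' hR.le (hcu.mono Icc_subset_Ici_self)
        (show s ∈ Icc (u R) (u ε) from ⟨by rw [huR]; exact hs.1.le, hs.2⟩)
      refine ⟨t, hRI t ⟨ht.1, lt_of_le_of_ne ht.2 ?_⟩, ht.1, hts⟩
      rintro rfl
      linarith [hs.1]
    · push Not at hz
      have hz' : ∀ r, ε ≤ r → 0 < u r ∧ v r < 0 := fun r hr => by
        have := lt_min_iff.1 (hz r hr)
        exact ⟨this.1, by linarith⟩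
      have hzI : ∀ r, ε ≤ r → r ∈ I := fun r hr => ⟨hε.trans_le hr, fun t ht => hz' t ht.1⟩
      have hlim := h.tendsto_zero_of_energy_nonneg h1 ha haε (fun r hr => hgI r (hzI r hr))
        (fun r hr => (hz' r hr).1) (fun r hr => (hz' r hr).2) (fun r hr => hEI r (hzI r hr) hr)
      obtain ⟨T, hT1, hT2⟩ := ((hlim.eventually (gt_mem_nhds hs.1)).and
        (eventually_ge_atTop ε)).exists
      obtain ⟨t, ht, hts⟩ := intermediate_value_Icc' hT2 (hcu.mono Icc_subset_Ici_self)
        (show s ∈ Icc (u T) (u ε) from ⟨hT1.le, hs.2⟩)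
      exact ⟨t, hzI t ht.1, ht.1, hts⟩
  obtain ⟨r, p, hprof, hval⟩ := exists_heightProfile (M := M) (f := f) (J := Ioc 0 (u ε)) hopen
    (fun t ht => ha.trans_lt (har.trans_lt ht.1)) hanti.injOn
    (fun t ht => h.hasDerivAt_u (har.trans_lt ht.1))
    (fun t ht => by rw [← hgI t ht]; exact h.hasDerivAt_v (har.trans_lt ht.1))
    (fun t ht => (huv t ht).2) (fun s hs => by
      obtain ⟨t, ht, _, hts⟩ := himg s hs
      exact ⟨t, ht, hts⟩)
  have hsub : Ioc 0 (u ε) ⊆ Ioo 0 α := fun s hs => ⟨hs.1, hs.2.trans_lt hα⟩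
  obtain ⟨c, hc, s₁, hs₁, hcs⟩ := hprof.exists_le_weightedSpeed hM h1 (hu ε hεm).1
    (hw.mono hsub)
    (fun s hs => by
      obtain ⟨t, ht, hεt, rfl⟩ := himg s hs
      obtain ⟨t', ht', htt'⟩ : ∃ t' ∈ I, t < t' := by
        obtain ⟨x, hx, hx'⟩ := (((hopen.eventually_mem ht).filter_mono
          (nhdsWithin_le_nhds (s := Ioi t))).and self_mem_nhdsWithin).exists
        exact ⟨x, hx, hx'⟩
      have hsubI : ∀ x ∈ Ioo t t', x ∈ I := fun x hx =>
        hdown t' ht' x (ht.1.trans hx.1) hx.2.le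
      have := h.radialEnergy_lt h1 ha hM (har.trans ht.1.le) htt'
        (fun x hx => hgI x (hsubI x hx)) (fun x hx => (huv x (hsubI x hx)).2)
      rw [(hval t ht).2, neg_sq]
      exact (hEI t' ht' (hεt.trans htt'.le)).trans_lt this)
    (fun s hs => (hT s ⟨hs.1, hs.2.trans_lt hα⟩).le)
    (by rwa [(hval ε hεI).2])
    (fun hβ => by
      have := hG hβ
      rwa [energyRatio, (hval ε hεI).1, (hval ε hεI).2, neg_sq])
    (fun hβ => by
      have := hW hβ
      rwa [weightedSpeed, (hval ε hεI).1, (hval ε hεI).2, neg_sq])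
  obtain ⟨s, hs, hlt⟩ := hsmall c hc s₁ hs₁
  exact absurd (hcs s hs) (not_le.2 hlt)

end IsRadialSolution

/-! ### Uniform positivity of launched solutions -/

lemma IsLaunched.exists_lower_bound {k : ℕ} {f g u v : ℝ → ℝ} {a b β r₀ α₁ K : ℝ}
    (h : IsLaunched k f g α₁ K a r₀ u v) (h1 : CondH1 f b β) (hβ : β < α₁)
    (hanti : StrictAntiOn u (Icc a r₀)) {R : ℝ} (hR : r₀ ≤ R)
    (hu : ∀ t ∈ Ioc r₀ R, 0 < u t) (hE : radialEnergy f u v R < 0) :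
    ∃ c > 0, ∀ r, a ≤ r → c ≤ u r := by
  have hα : 0 < α₁ := h1.beta_pos.trans hβ
  have hpos : ∀ t ∈ Icc a R, 0 < u t := by
    intro t ht
    rcases le_or_gt t r₀ with htr | htr
    · have := hanti.antitoneOn ⟨ht.1, htr⟩ ⟨h.a_le, le_rfl⟩ htr
      rw [h.u_eq] at this
      linarith
    · exact hu t ⟨htr, ht.2⟩
  have haR : a ≤ R := h.a_le.trans hR
  obtain ⟨c, hc, hcR⟩ := h.sol.exists_lower_bound h1 h.a_nonneg h.g_eq hβ haR
    (hpos R ⟨haR, le_rfl⟩) hE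
  -- Up to `R` compactness gives the bound; afterwards the energy trap does.
  obtain ⟨x, hx, hmin⟩ := (isCompact_Icc (a := a) (b := R)).exists_isMinOn ⟨a, le_rfl, haR⟩
    (h.sol.continuousOn_u.mono Icc_subset_Ici_self)
  refine ⟨min c (u x), lt_min hc (hpos x hx), fun r hr => ?_⟩
  rcases le_total r R with hrR | hrR
  · exact (min_le_right _ _).trans (hmin ⟨hr, hrR⟩)
  · exact (min_le_left _ _).trans (hcR r hrR)

/-- Positivity when the limiting height `α₁ - K/k` lies below `β`. -/
lemma exists_lower_bound_of_lt_beta {k : ℕ} {f : ℝ → ℝ} {b β α₁ K : ℝ} (h1 : CondH1 f b β)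
    (hk : 1 ≤ k) (hβ : β < α₁) (hK : 0 < K) (hα₀ : 0 < α₁ - K / k) (hlt : α₁ - K / k < β) :
    ∃ δ > 0, ∀ (g u v : ℝ → ℝ) (a r₀ : ℝ), r₀ < δ → IsLaunched k f g α₁ K a r₀ u v →
      StrictAntiOn u (Icc a r₀) → ∃ c > 0, ∀ r, a ≤ r → c ≤ u r := by
  set α₀ := α₁ - K / k with hα₀def
  have hF := h1.primitiveF_neg hα₀ hlt
  obtain ⟨κ, hκ, hκF⟩ : ∃ κ > 0, ∀ x y, |x - α₀| ≤ κ → |y| ≤ κ → y ^ 2 + 2 * primitiveF f x < 0 := by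
    have hc : Continuous (fun z : ℝ × ℝ => z.2 ^ 2 + 2 * primitiveF f z.1) :=
      (continuous_snd.pow 2).add ((h1.continuous_primitiveF.comp continuous_fst).const_smul (2 : ℝ))
    have := (hc.tendsto (α₀, 0)).eventually
      (gt_mem_nhds (show (0 : ℝ) ^ 2 + 2 * primitiveF f α₀ < 0 by linarith))
    obtain ⟨κ, hκ, hball⟩ := Metric.eventually_nhds_iff.1 this
    refine ⟨κ / 2, by linarith, fun x y hx hy => hball (y := (x, y)) ?_⟩
    rw [Prod.dist_eq, Real.dist_eq, Real.dist_eq, sub_zero]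
    exact max_lt (by linarith) (by linarith)
  obtain ⟨ε, hε, _, δ, hδ, harr⟩ := exists_arrival h1 hk (h1.b_lt_beta.trans hβ) hK hα₀ hκ
    (τ := 1 / 2) ⟨by norm_num, by norm_num⟩
  refine ⟨δ, hδ, fun g u v a r₀ hr₀ h hanti => ?_⟩
  obtain ⟨c1, hin, hlow, hup, hvε⟩ := harr g u v a r₀ hr₀ h
  have hrε : r₀ ≤ ε := by linarith
  refine h.exists_lower_bound h1 hβ hanti hrε (fun t ht => (hin t ht).1) (hκF _ _ ?_ hvε)
  rw [abs_le]
  constructor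
  · linarith [hlow ε ⟨hrε, le_rfl⟩]
  · linarith [hup ε ⟨by linarith, le_rfl⟩]

/-- Positivity when the limiting height `α₁ - K/k` lies in `[β, α)`, with `α` the value of a ground
state. -/
lemma exists_lower_bound_of_beta_le {k : ℕ} {f : ℝ → ℝ} {b β α α₁ K : ℝ} (h1 : CondH1 f b β)
    (h2 : CondH2 (k + 1 + 1) f β) (hα : IsGroundStateValue (k + 1 + 1) f α)
    (hk : 1 ≤ k) (hβ : β < α₁) (hK : 0 < K) (hle : β ≤ α₁ - K / k) (hlt : α₁ - K / k < α) :
    ∃ δ > 0, ∀ (g u v : ℝ → ℝ) (a r₀ : ℝ), r₀ < δ → IsLaunched k f g α₁ K a r₀ u v →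
      StrictAntiOn u (Icc a r₀) → ∃ c > 0, ∀ r, a ≤ r → c ≤ u r := by
  obtain ⟨-, ρ, q, hw, hEw, hT, hsmall⟩ := exists_groundState_profile h1 h2 (by omega) hα
  set α₀ := α₁ - K / k with hα₀def
  have hα₀ : 0 < α₀ := h1.beta_pos.trans_le hle
  have hmem : α₀ ∈ Ioo 0 α := ⟨hα₀, hlt⟩
  have hf0 : 0 < f α₀ := h1.pos_of_gt _ (h1.b_lt_beta.trans_le hle)
  have hq0 := hw.p_pos _ hmem
  have hT0 := hT α₀ ⟨hle, hlt⟩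
  push_cast at hT0
  -- The strict Pohozaev inequality leaves room for `μ²`. One factor pays for `f(u) ≥ μ f(α₀)` near
  -- `α₀`, the other for integrating the flux only over `[τε, ε]`, which costs `1 - τ^(k+2) > μ`.
  obtain ⟨μ, hμ, hμ'⟩ : ∃ μ ∈ Ioo (0 : ℝ) 1,
      2 * (k + 1 + 1) * primitiveF f α₀ / (μ ^ 2 * f α₀) < energyRatio f ρ q α₀ := by
    have hc : ContinuousAt (fun μ : ℝ => 2 * (k + 1 + 1) * primitiveF f α₀ / (μ ^ 2 * f α₀)) 1 :=
      continuousAt_const.div (by fun_prop) (by simpa using hf0.ne')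
    have hl : 2 * (k + 1 + 1) * primitiveF f α₀ / ((1 : ℝ) ^ 2 * f α₀) < energyRatio f ρ q α₀ := by
      rw [one_pow, one_mul, div_lt_iff₀ hf0]
      linarith
    obtain ⟨μ, e1, e2⟩ := (((hc.eventually (gt_mem_nhds hl)).filter_mono
      nhdsWithin_le_nhds).and (Ioo_mem_nhdsLT (zero_lt_one (α := ℝ)))).exists
    exact ⟨μ, e2, e1⟩
  obtain ⟨τ, hτ, hτμ⟩ : ∃ τ ∈ Ioo (0 : ℝ) 1, μ < 1 - τ ^ (k + 1 + 1) := by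
    have hc : Continuous (fun τ : ℝ => 1 - τ ^ (k + 1 + 1)) := by fun_prop
    obtain ⟨τ, e1, e2⟩ := ((((hc.tendsto 0).eventually
      (lt_mem_nhds (a := μ) (by simpa using hμ.2))).filter_mono
      nhdsWithin_le_nhds).and (Ioo_mem_nhdsGT (zero_lt_one (α := ℝ)))).exists
    exact ⟨τ, e2, e1⟩
  obtain ⟨κ, hκ, hκs⟩ : ∃ κ > 0, ∀ s, |s - α₀| ≤ κ → s < α ∧ b < s ∧ κ < q s ∧
      κ < weightedSpeed f ρ q s ∧ μ * f α₀ ≤ f s ∧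
      2 * (k + 1 + 1) * primitiveF f s / (μ ^ 2 * f α₀) + κ < energyRatio f ρ q s := by
    have hcq := (hw.deriv_p _ hmem).continuousAt
    have hW0 : 0 < weightedSpeed f ρ q α₀ :=
      mul_pos (hw.r_pos _ hmem) (Real.sqrt_pos.2 (hEw _ hmem))
    have hcW := (hw.hasDerivAt_weightedSpeed h1 hmem (hEw _ hmem)).continuousAt
    have hcG : ContinuousAt (fun s => energyRatio f ρ q s -
        2 * (k + 1 + 1) * primitiveF f s / (μ ^ 2 * f α₀)) α₀ :=
      (hw.hasDerivAt_energyRatio h1 hmem).continuousAt.sub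
        ((continuousAt_const.mul h1.continuous_primitiveF.continuousAt).div_const _)
    set c := min (min (q α₀ / 2) (weightedSpeed f ρ q α₀ / 2))
      ((energyRatio f ρ q α₀ - 2 * (k + 1 + 1) * primitiveF f α₀ / (μ ^ 2 * f α₀)) / 2)
    have hc0 : 0 < c := lt_min (lt_min (by linarith) (by linarith)) (by linarith)
    have l1 : c < q α₀ := by
      linarith [(min_le_left _ _ : c ≤ _).trans (min_le_left _ _)]
    have l2 : c < weightedSpeed f ρ q α₀ := by
      linarith [(min_le_left _ _ : c ≤ _).trans (min_le_right _ _)]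
    have l3 : c < energyRatio f ρ q α₀ -
        2 * (k + 1 + 1) * primitiveF f α₀ / (μ ^ 2 * f α₀) := by
      linarith [(min_le_right _ _ : c ≤ _)]
    have l4 : μ * f α₀ < f α₀ := by nlinarith [hμ.2]
    obtain ⟨η, hη, hball⟩ := Metric.eventually_nhds_iff.1
      ((((((gt_mem_nhds hlt).and (lt_mem_nhds (h1.b_lt_beta.trans_le hle))).and
        (hcq.eventually (lt_mem_nhds l1))).and (hcW.eventually (lt_mem_nhds l2))).and
        (h1.continuous.continuousAt.eventually (lt_mem_nhds l4))).and
        (hcG.eventually (lt_mem_nhds l3)))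
    refine ⟨min c (η / 2), lt_min hc0 (by linarith), fun s hs => ?_⟩
    obtain ⟨⟨⟨⟨⟨e1, e2⟩, e3⟩, e4⟩, e5⟩, e6⟩ := hball (y := s) (by
      rw [Real.dist_eq]
      linarith [hs.trans (min_le_right _ _)])
    have hm := min_le_left c (η / 2)
    exact ⟨e1, e2, hm.trans_lt e3, hm.trans_lt e4, e5.le, by linarith⟩
  obtain ⟨ε, hε, hε1, δ, hδ, harr⟩ := exists_arrival h1 hk (h1.b_lt_beta.trans hβ) hK hα₀ hκ hτ
  refine ⟨δ, hδ, fun g u v a r₀ hr₀ h hanti => ?_⟩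
  obtain ⟨c1, hin, hlow, hup, hvε⟩ := harr g u v a r₀ hr₀ h
  have hτε' : τ * ε ≤ ε := by nlinarith [hτ.2]
  have hrε : r₀ < ε := c1.trans_le hτε'
  have hbu : ∀ t ∈ Icc r₀ ε, b < u t := fun t ht =>
    (hκs (α₀ - κ) (by simp [abs_of_pos hκ])).2.1.trans_le (hlow t ht)
  have hvneg : ∀ t ∈ Icc r₀ ε, v t < 0 := fun t ht => h.v_neg_of_gt h1 ht.1
    (fun x hx => ⟨hbu x ⟨hx.1.le, hx.2.le.trans ht.2⟩,
      (hin x ⟨hx.1, hx.2.le.trans ht.2⟩).2.le⟩)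
  have hnear : ∀ t ∈ Icc (τ * ε) ε, |u t - α₀| ≤ κ := fun t ht => by
    rw [abs_le]
    constructor
    · linarith [hlow t ⟨c1.le.trans ht.1, ht.2⟩]
    · linarith [hup t ht]
  obtain ⟨hsα, hsb, hsq, hsW, -, hsG⟩ := hκs (u ε) (hnear ε ⟨hτε', le_rfl⟩)
  have hvε0 : v ε < 0 := hvneg ε ⟨hrε.le, le_rfl⟩
  have hpκ : -v ε ≤ κ := by linarith [(abs_le.1 hvε).1]
  -- a lower bound for the slope at `ε`
  have hplow : μ ^ 2 * f α₀ * ε ≤ (k + 1 + 1) * -v ε := by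
    have hpow : ∀ t, HasDerivAt (fun t : ℝ => μ * f α₀ / (k + 1 + 1) * t ^ (k + 1 + 1))
        (μ * f α₀ * t ^ (k + 1)) t := fun t =>
      ((hasDerivAt_pow (k + 1 + 1) t).const_mul (μ * f α₀ / (k + 1 + 1))).congr_deriv (by
        have : (k : ℝ) + 1 + 1 ≠ 0 := by positivity
        push_cast
        field_simp)
    have e := le_of_hasDerivAt_nonneg
      (φ := fun t => -(t ^ (k + 1) * v t) - μ * f α₀ / (k + 1 + 1) * t ^ (k + 1 + 1)) hτε'
      ((h.continuousOn_flux.neg.mono (fun t ht => c1.le.trans ht.1)).sub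
        (Continuous.continuousOn (by fun_prop)))
      (fun t ht => (h.hasDerivAt_flux (c1.trans ht.1)
        (Ioo_subset_Icc_self (hin t ⟨c1.trans ht.1, ht.2.le⟩))).neg.sub (hpow t))
      (fun t ht => by
        have h3 := (hκs (u t) (hnear t (Ioo_subset_Icc_self ht))).2.2.2.2.1
        have h4 := mul_le_mul_of_nonneg_left h3
          (pow_pos (h.r_pos.trans (c1.trans ht.1)) (k + 1)).le
        linarith)
    have hτε : 0 < τ * ε := mul_pos hτ.1 hε
    have h3 := mul_neg_of_pos_of_neg (pow_pos hτε (k + 1)) (hvneg (τ * ε) ⟨c1.le, hτε'⟩)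
    have hεk := pow_pos hε (k + 1)
    have h4 : μ * f α₀ / (k + 1 + 1) * (ε ^ (k + 1) * ε * (1 - τ ^ (k + 1 + 1))) ≤
        ε ^ (k + 1) * -v ε := by
      have : μ * f α₀ / (k + 1 + 1) * (ε ^ (k + 1) * ε * (1 - τ ^ (k + 1 + 1))) =
        μ * f α₀ / (k + 1 + 1) * ε ^ (k + 1 + 1) -
          μ * f α₀ / (k + 1 + 1) * (τ * ε) ^ (k + 1 + 1) := by ring
      linarith
    have h5 : μ * f α₀ / (k + 1 + 1) * (ε ^ (k + 1) * ε * μ) ≤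
        μ * f α₀ / (k + 1 + 1) * (ε ^ (k + 1) * ε * (1 - τ ^ (k + 1 + 1))) := by
      have := hμ.1
      gcongr
    have h6 : ε ^ (k + 1) * (μ ^ 2 * f α₀ * ε / (k + 1 + 1)) ≤ ε ^ (k + 1) * -v ε := by
      refine le_trans (le_of_eq ?_) (h5.trans h4)
      ring
    have h7 := le_of_mul_le_mul_left h6 hεk
    rw [div_le_iff₀ (by positivity)] at h7
    linarith
  obtain ⟨R, hR, hRu, hRE⟩ := h.sol.exists_radialEnergy_neg h1 (by omega) h.a_nonneg h.g_eq hw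
    hT hsmall h.a_le hrε hin (fun t ht => hvneg t (Ioc_subset_Icc_self ht)) hsα
    (hpκ.trans_lt hsq)
    -- The ratio splits as `2F ε/p + ε p` with `p = -v ε`. The lower bound on `p` controls the first
    -- term, and smallness of `p` with `ε ≤ 1` the second.
    (fun hβu => by
      refine lt_of_le_of_lt ?_ hsG
      have hF := h1.primitiveF_nonneg hβu
      have hp : 0 < -v ε := by linarith
      have hμ0 := hμ.1
      have e1 : ε * radialEnergy f u v ε / -v ε =
          2 * primitiveF f (u ε) * (ε / -v ε) + ε * -v ε := by
        simp only [radialEnergy]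
        have := hvε0.ne
        field_simp
        ring
      have e2 : ε / -v ε ≤ (k + 1 + 1) / (μ ^ 2 * f α₀) := by
        rw [div_le_div_iff₀ hp (by positivity)]
        linarith
      have e3 : ε * -v ε ≤ κ := by nlinarith
      have e4 := mul_le_mul_of_nonneg_left e2 (show 0 ≤ 2 * primitiveF f (u ε) by linarith)
      rw [e1]
      refine add_le_add (e4.trans (le_of_eq ?_)) e3
      ring)
    (fun hβu => by
      refine lt_of_le_of_lt ?_ hsW
      have hF := h1.primitiveF_nonpos (hin ε ⟨hrε, le_rfl⟩).1.le hβu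
      have e1 : √(radialEnergy f u v ε) ≤ κ := by
        rw [Real.sqrt_le_left hκ.le]
        simp only [radialEnergy]
        nlinarith
      have e2 := Real.sqrt_nonneg (radialEnergy f u v ε)
      nlinarith)
  refine h.exists_lower_bound h1 hβ hanti (hrε.le.trans hR) (fun t ht => ?_) hRE
  rcases le_total t ε with htε | htε
  · exact (hin t ⟨ht.1, htε⟩).1
  · exact hRu t ⟨htε, ht.2⟩

/-! ### Existence of admissible `K`, and the main theorem -/

lemma exists_isAdmissible {N : ℕ} (hN : 2 < N) {f : ℝ → ℝ} {b β αs α₁ : ℝ} (h1 : CondH1 f b β)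
    (h3 : CondH3 N f b β) (hβ : β < αs) (hα : αs < α₁) (hd : DifferentiableAt ℝ f α₁) :
    ∃ K : ℝ, IsAdmissible N f αs α₁ K := by
  have hN' : (0 : ℝ) < N - 2 := by
    have : (2 : ℝ) < N := by exact_mod_cast hN
    linarith
  have hαs : 0 < αs := h1.beta_pos.trans hβ
  have hf := h1.pos_of_gt α₁ (h1.b_lt_beta.trans (hβ.trans hα))
  have hN0 : (0 : ℝ) < N := by linarith
  have hle := h3.antitoneOn ⟨h1.b_lt_beta, h3.differentiableAt_beta⟩
    ⟨h1.b_lt_beta.trans (hβ.trans hα), hd⟩ (hβ.trans hα).le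
  have hlt := hle.trans_lt h3.lt_at_beta
  simp only at hlt
  rw [div_lt_div_iff₀ hf hN'] at hlt
  -- The midpoint of the interval from `(N-2)(α₁ - αs)` to `(N-2) α₁`. By `(H₃)`, `α₁ f'(α₁)/f(α₁) <
  -- N/(N-2)`, so the remaining bound already holds at the upper end when `f'(α₁) > 0`.
  refine ⟨(N - 2) * (α₁ - αs / 2), ?_, ?_, ?_⟩
  · have := mul_pos hN' hαs
    linarith
  · rcases le_or_gt (deriv f α₁) 0 with hle0 | hgt
    · have : 0 < ((N : ℝ) - 2) * (α₁ - αs / 2) := mul_pos hN' (by linarith)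
      nlinarith [mul_pos hN0 hf]
    · have := mul_pos (mul_pos hN' hαs) hgt
      linarith
  · have := mul_pos hN' hαs
    linarith

theorem mainTheorem7 (N : ℕ) (hN : 2 < N) (f : ℝ → ℝ) (b β : ℝ)
    (h1 : CondH1 f b β) (h2 : CondH2 N f β)
    (αs α₁ : ℝ) (hαs : IsGroundStateValue N f αs) (hα : αs < α₁)
    (hd : DifferentiableAt ℝ f α₁) :
    (∀ K : ℝ, IsAdmissible N f αs α₁ K →
      ∃ δ > 0, ∀ (g u v : ℝ → ℝ) (a r₀ : ℝ),
        (∀ s ∈ Set.Icc 0 α₁, g s = f s) →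
        0 ≤ a → a ≤ r₀ → 0 < r₀ → r₀ < δ →
        IsRadialSolution N g a u v →
        StrictAntiOn u (Set.Icc a r₀) → u r₀ = α₁ → v r₀ < 0 → |v r₀ * r₀| = K →
        ∃ c > 0, ∀ r, a ≤ r → c ≤ u r) ∧
    (CondH3 N f b β → ∃ K : ℝ, IsAdmissible N f αs α₁ K) := by
  obtain ⟨k, rfl⟩ : ∃ k, N = k + 1 + 1 := ⟨N - 2, by omega⟩
  have hk : 1 ≤ k := by omega
  have hβ := (exists_groundState_profile h1 h2 (by omega) hαs).1
  refine ⟨fun K hK => ?_, fun h3 => exists_isAdmissible hN h1 h3 hβ hα hd⟩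
  obtain ⟨hK1, -, hK2⟩ := hK
  have hkN : (((k + 1 + 1 : ℕ) : ℝ) - 2) = k := by push_cast; ring
  rw [hkN] at hK1 hK2
  have hk0 : (0 : ℝ) < k := by exact_mod_cast hk
  have hK0 : 0 < K := (mul_pos hk0 (sub_pos.2 hα)).trans hK1
  have hlow : 0 < α₁ - K / k := by
    rw [sub_pos, div_lt_iff₀ hk0]; linarith
  have hup : α₁ - K / k < αs := by
    rw [sub_lt_comm, lt_div_iff₀ hk0]; linarith
  obtain ⟨δ, hδ, hmain⟩ : ∃ δ > 0, ∀ (g u v : ℝ → ℝ) (a r₀ : ℝ), r₀ < δ →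
      IsLaunched k f g α₁ K a r₀ u v →
      StrictAntiOn u (Icc a r₀) → ∃ c > 0, ∀ r, a ≤ r → c ≤ u r := by
    rcases lt_or_ge (α₁ - K / k) β with hlt | hge
    · exact exists_lower_bound_of_lt_beta h1 hk (hβ.trans hα) hK0 hlow hlt
    · exact exists_lower_bound_of_beta_le h1 h2 hαs hk (hβ.trans hα) hK0 hge hup
  refine ⟨δ, hδ, fun g u v a r₀ hg ha har hr hrδ hsol hanti hur hvr hslope => ?_⟩
  refine hmain g u v a r₀ hrδ ⟨hsol, hg, ha, har, hr, hur, hvr, ?_⟩ hanti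
  rw [← hslope, abs_of_neg (mul_neg_of_neg_of_pos hvr hr)]
  ring
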